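/- All generating functions are formal power series in $z$ with coefficients in $\mathbb{Q}[w]$. Write $\sum_n a_n(w)\frac{z^n}{n!}\odot\sum_n b_n(w)\frac{z^n}{n!}=\sum_n a_n(w)b_n(w)\frac{z^n}{n!}$ for the exponential Hadamard product with respect to $z$. Let $G(z)=G(z,w)$ be the exponential generating function of simple graphs with vertex set $\{1,\dots,n\}$, $n\ge 0$ (with $z$ marking vertices and $w$ edges). Let $D(z)=D(z,w)$ and $\mathrm{SCC}(z)=\mathrm{SCC}(z,w)$ be the exponential generating functions of all labeled digraphs without loops and multiple arcs (opposite arcs $u\to v$ and $v\to u$ may both be present) and of those that are nonempty and strongly connected, respectively (with $z$ marking vertices and $w$ arcs). A 2-CNF on $n$ Boolean variables is a set of clauses, each an unordered pair of literals of two distinct variables. Its implication digraph has the $2n$ literals as vertices, and each clause $k\vee\ell$ gives the arcs $\overline{k}\to\ell$ and $\overline{\ell}\to k$. A variable $x$ is contradictory if the implication digraph has oriented paths from $x$ to $\overline{x}$ and from $\overline{x}$ to $x$; a strongly connected component of the implication digraph is contradictory if it contains a contradictory variable. Let $\mathrm{CSCC}(z)=\mathrm{CSCC}(z,w)$ be the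 exponential generating function of the 2-CNFs whose implication digraph consists of a single contradictory strongly connected component, where $z$ marks the Boolean variables and $w$ the clauses (so the coefficient of $w^m\frac{z^n}{n!}$ is the number of such 2-CNFs with $n$ variables and $m$ clauses). Theorem. As formal power series, $$\mathrm{CSCC}(z)=\tfrac12\,\mathrm{SCC}(2z)+\log\!\left(D(z)\odot\frac{D(z)}{G(2z)}\right).$$ -/

import Mathlib

open Polynomial PowerSeries

noncomputable section

namespace TwoSat

/-! ### Bivariate generating functions

Generating functions are formal power series in `z` whose coefficients are polynomials in `w`. -/

/-- The exponential generating function `∑ aₙ(w) zⁿ / n!` of a sequence of polynomials. -/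
def egf (a : ℕ → ℚ[X]) : ℚ[X]⟦X⟧ :=
  PowerSeries.mk fun n => ((n.factorial : ℚ)⁻¹) • a n

/-- The exponential Hadamard product with respect to `z`:
`(∑ aₙ zⁿ / n!) ⊙ (∑ bₙ zⁿ / n!) = ∑ aₙ bₙ zⁿ / n!`. In terms of the plain coefficients
`aₙ / n!` and `bₙ / n!`, the `n`-th coefficient is `n! * (aₙ / n!) * (bₙ / n!)`. -/
def hadamard (A B : ℚ[X]⟦X⟧) : ℚ[X]⟦X⟧ :=
  PowerSeries.mk fun n =>
    (n.factorial : ℚ) • (PowerSeries.coeff n A * PowerSeries.coeff n B)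

theorem hadamard_egf (a b : ℕ → ℚ[X]) :
    hadamard (egf a) (egf b) = egf fun n => a n * b n := by
  ext1 n
  have h : (n.factorial : ℚ) ≠ 0 := by exact_mod_cast n.factorial_ne_zero
  simp only [hadamard, egf, PowerSeries.coeff_mk, smul_mul_smul_comm, smul_smul]
  congr 1
  field_simp

/-! ### Graphs and digraphs -/

/-- The number of arcs of a digraph. -/
def arcCount {V : Type*} (D : Digraph V) : ℕ :=
  {p : V × V | D.Adj p.1 p.2}.ncard

/-- There is an oriented path (possibly of length zero) from `u` to `v`. -/
def Reachable {V : Type*} (D : Digraph V) (u v : V) : Prop :=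
  Relation.ReflTransGen D.Adj u v

/-- A strongly connected digraph: it has a vertex, and there is an oriented path between any two
vertices. -/
def IsStronglyConnected {V : Type*} (D : Digraph V) : Prop :=
  Nonempty V ∧ ∀ u v : V, Reachable D u v

/-- `C` is a strongly connected component of `D`. -/
def IsSCC {V : Type*} (D : Digraph V) (C : Set V) : Prop :=
  C.Nonempty ∧ Maximal (fun S : Set V => ∀ u ∈ S, ∀ v ∈ S, Reachable D u v) C

open Classical in
/-- `G(z, w)`: the exponential generating function of simple graphs, `z` marking the vertices and
`w` the edges. -/
def graphGF : ℚ[X]⟦X⟧ :=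
  egf fun n => ∑ G : SimpleGraph (Fin n), Polynomial.X ^ G.edgeSet.ncard

open Classical in
/-- The exponential generating function of the loopless digraphs that satisfy `P`, `z` marking the
vertices and `w` the arcs. -/
def digraphFamilyGF (P : ∀ n : ℕ, Digraph (Fin n) → Prop) : ℚ[X]⟦X⟧ :=
  egf fun n => ∑ D : Digraph (Fin n) with (∀ v, ¬ D.Adj v v) ∧ P n D, Polynomial.X ^ arcCount D

/-- `D(z, w)`: the exponential generating function of all loopless digraphs. -/
def digraphGF : ℚ[X]⟦X⟧ :=
  digraphFamilyGF fun _ _ => True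

/-- `SCC(z, w)`: the exponential generating function of strongly connected loopless digraphs. -/
def sccGF : ℚ[X]⟦X⟧ :=
  digraphFamilyGF fun _ D => IsStronglyConnected D

/-! ### 2-CNFs and implication digraphs -/

/-- The literals of `n` Boolean variables: `(i, true)` is the variable `i` and `(i, false)` is its
negation. -/
abbrev Literal (n : ℕ) : Type := Fin n × Bool

/-- The negation of a literal. -/
def Literal.neg {n : ℕ} (x : Literal n) : Literal n := (x.1, !x.2)

/-- A 2-CNF on `n` variables: a set of clauses, each of which is an unordered pair of literals
of distinct variables. -/
def IsTwoCNF {n : ℕ} (F : Finset (Sym2 (Literal n))) : Prop :=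
  ∀ k l : Literal n, s(k, l) ∈ F → k.1 ≠ l.1

/-- The implication digraph of a set of clauses: a clause `k ∨ l` gives the arcs `¬k → l` and
`¬l → k`. Thus `x → y` is an arc exactly when `¬x ∨ y` is a clause. -/
def implicationDigraph {n : ℕ} (F : Finset (Sym2 (Literal n))) : Digraph (Literal n) where
  Adj x y := s(x.neg, y) ∈ F

/-- The variable `i` is contradictory: there are oriented paths from `i` to `¬i` and from `¬i`
to `i` in the implication digraph. -/
def IsContradictoryVariable {n : ℕ} (F : Finset (Sym2 (Literal n))) (i : Fin n) : Prop :=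
  Reachable (implicationDigraph F) (i, true) (i, false) ∧
    Reachable (implicationDigraph F) (i, false) (i, true)

/-- A contradictory strongly connected component of the implication digraph: one that contains a
(literal of a) contradictory variable. -/
def IsContradictorySCC {n : ℕ} (F : Finset (Sym2 (Literal n))) (C : Set (Literal n)) : Prop :=
  IsSCC (implicationDigraph F) C ∧ ∃ x ∈ C, IsContradictoryVariable F x.1

open Classical in
/-- `CSCC(z, w)`: the exponential generating function of the 2-CNFs whose implication digraph
consists of a single contradictory strongly connected component, `z` marking the Boolean variables
(half the number of vertices) and `w` the clauses (half the number of arcs). -/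
def csccGF : ℚ[X]⟦X⟧ :=
  egf fun n => ∑ F : Finset (Sym2 (Literal n)) with
    IsTwoCNF F ∧ IsContradictorySCC F Set.univ, Polynomial.X ^ F.card

/-! ### The quotient and the logarithm below are taken at admissible series -/

theorem constantCoeff_graphGF : PowerSeries.constantCoeff graphGF = 1 := by
  have h (G : SimpleGraph (Fin 0)) : G.edgeSet.ncard = 0 := by
    simp [Set.eq_empty_of_isEmpty]
  rw [← PowerSeries.coeff_zero_eq_constantCoeff_apply]
  simp [graphGF, egf, h]

theorem constantCoeff_digraphGF : PowerSeries.constantCoeff digraphGF = 1 := by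
  have h (D : Digraph (Fin 0)) : arcCount D = 0 := by
    simp [arcCount, Set.eq_empty_of_isEmpty]
  rw [← PowerSeries.coeff_zero_eq_constantCoeff_apply]
  simp [digraphGF, digraphFamilyGF, egf, h]

/-- The series `G(2z)` is invertible. -/
theorem isUnit_rescale_graphGF : IsUnit (PowerSeries.rescale (2 : ℚ[X]) graphGF) := by
  rw [PowerSeries.isUnit_iff_constantCoeff, ← PowerSeries.coeff_zero_eq_constantCoeff_apply,
    PowerSeries.coeff_rescale, PowerSeries.coeff_zero_eq_constantCoeff_apply,
    constantCoeff_graphGF]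
  simp

/-- The series `D(z) ⊙ (D(z) / G(2z))` has constant term `1`. -/
theorem constantCoeff_hadamard_quotient :
    PowerSeries.constantCoeff (hadamard digraphGF
      (digraphGF * Ring.inverse (PowerSeries.rescale (2 : ℚ[X]) graphGF))) = 1 := by
  have h := congrArg PowerSeries.constantCoeff
    (Ring.mul_inverse_cancel _ isUnit_rescale_graphGF)
  have h2 : PowerSeries.constantCoeff (PowerSeries.rescale (2 : ℚ[X]) graphGF) = 1 := by
    rw [← PowerSeries.coeff_zero_eq_constantCoeff_apply, PowerSeries.coeff_rescale,
      PowerSeries.coeff_zero_eq_constantCoeff_apply, constantCoeff_graphGF]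
    simp
  rw [map_mul, h2, one_mul, map_one] at h
  rw [← PowerSeries.coeff_zero_eq_constantCoeff_apply]
  simp [hadamard, constantCoeff_digraphGF, h]

end TwoSat

end

noncomputable section

namespace TwoSat

/-! ### Exponential generating functions and the formal logarithm -/

/-! The formula is read as `exp (CSCC(z) - SCC(2z)/2) = D(z) ⊙ (D(z) / G(2z))`. The left side counts
2-CNFs with signs: by contraposition the components of an implication digraph are either
contradictory or come in pairs `X`, `negSet X` of ordinary ones. Give weight `0` to a set of clauses
having an arc between different components, and otherwise a factor `-1` for each ordinary pair. A
pair on `k` variables is a strongly connected digraph placed on one of `2 ^ k / 2` choices of signs,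
so the connected pieces are counted by `CSCC(z) - SCC(2z)/2` (`componentSum_eq_componentSeq`).
Marking one variable gives the recursion `signedSeq_succ`, which is the differential equation of the
exponential.

The right side comes from an identity for each single set of clauses `F` (`sum_residualWeight`):
over the partial assignments `T` closed under implication, the signed weights of what `T` leaves
unassigned sum to `1`. The proof is by induction along a consistent sink component `X`. A closed `T`
contains `X`, contains `negSet X`, or avoids both. Assignments of the first kind reduce to the
problem without `X`. Those of the other two kinds cancel in pairs, since adding `negSet X` to `T`
removes one ordinary pair, or else the weight was already zero. When every variable is
contradictory, only the empty assignment is closed.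

Summing over all `F` (`one_add_X_pow_card_clauses`) gives, with `d n = (1+w)^(n(n-1))` and `e` the
signed counts, `d n * d n = ∑ (n choose i) e i * (d (i+j) / d i) * 2^j (1+w)^(j choose 2)` over `i +
j = n`. Cancelling `d n` turns this into `D(z) = Q(z) G(2z)`, where `Q` has numerators `e i / d i`;
hence `E = D ⊙ (D / G(2z))` (`logOf_hadamard_quotient`). -/

theorem coeff_egf (a : ℕ → ℚ[X]) (n : ℕ) :
    PowerSeries.coeff n (egf a) = ((n.factorial : ℚ)⁻¹) • a n :=
  PowerSeries.coeff_mk _ _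

theorem exists_eq_egf (A : ℚ[X]⟦X⟧) : ∃ a : ℕ → ℚ[X], A = egf a := by
  refine ⟨fun n => (n.factorial : ℚ) • PowerSeries.coeff n A, ?_⟩
  ext1 n
  have h : (n.factorial : ℚ) ≠ 0 := by exact_mod_cast n.factorial_ne_zero
  rw [coeff_egf, smul_smul, inv_mul_cancel₀ h, one_smul]

theorem egf_injective : Function.Injective egf := by
  intro a b hab
  funext n
  have h : (n.factorial : ℚ)⁻¹ ≠ 0 := inv_ne_zero (by exact_mod_cast n.factorial_ne_zero)
  have := congrArg (PowerSeries.coeff n) hab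
  rw [coeff_egf, coeff_egf] at this
  exact smul_right_injective _ h this

theorem egf_mul (a b : ℕ → ℚ[X]) :
    egf a * egf b = egf fun n => ∑ ij ∈ Finset.HasAntidiagonal.antidiagonal n,
      (n.choose ij.1 : ℚ) • (a ij.1 * b ij.2) := by
  ext1 n
  rw [PowerSeries.coeff_mul, coeff_egf, Finset.smul_sum]
  refine Finset.sum_congr rfl fun ij hij => ?_
  obtain rfl := Finset.HasAntidiagonal.mem_antidiagonal.mp hij
  rw [coeff_egf, coeff_egf, smul_mul_smul_comm, smul_smul]
  congr 1
  have h1 : ((ij.1 + ij.2).factorial : ℚ) ≠ 0 := by exact_mod_cast Nat.factorial_ne_zero _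
  have h2 : (ij.1.factorial : ℚ) ≠ 0 := by exact_mod_cast Nat.factorial_ne_zero _
  have h3 : (ij.2.factorial : ℚ) ≠ 0 := by exact_mod_cast Nat.factorial_ne_zero _
  have h4 : ((ij.1 + ij.2).choose ij.1 : ℚ) * ij.1.factorial * ij.2.factorial
      = (ij.1 + ij.2).factorial := by
    rw [Nat.choose_symm_add]
    exact_mod_cast Nat.add_choose_mul_factorial_mul_factorial ij.1 ij.2
  field_simp
  linarith

theorem derivative_egf (a : ℕ → ℚ[X]) :
    d⁄dX ℚ[X] (egf a) = egf fun n => a (n + 1) := by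
  ext1 n
  rw [PowerSeries.coeff_derivative, coeff_egf, coeff_egf]
  have h : ((n : ℚ[X]) + 1) = algebraMap ℚ ℚ[X] ((n : ℚ) + 1) := by simp
  rw [h, mul_comm, ← Algebra.smul_def, smul_smul]
  congr 1
  have h1 : (n.factorial : ℚ) ≠ 0 := by exact_mod_cast n.factorial_ne_zero
  have h2 : (n : ℚ) + 1 ≠ 0 := by exact_mod_cast n.succ_ne_zero
  rw [Nat.factorial_succ]
  push_cast
  field_simp

theorem constantCoeff_egf (a : ℕ → ℚ[X]) : PowerSeries.constantCoeff (egf a) = a 0 := by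
  rw [← PowerSeries.coeff_zero_eq_constantCoeff_apply, coeff_egf]
  simp

theorem rescale_egf (r : ℚ[X]) (a : ℕ → ℚ[X]) :
    PowerSeries.rescale r (egf a) = egf fun n => r ^ n * a n := by
  ext1 n
  rw [PowerSeries.coeff_rescale, coeff_egf, coeff_egf, mul_smul_comm]

/-- The logarithm of `H` is the series `C` without constant term such that `H' = C' H`. -/
theorem logOf_eq_of_derivative_eq {A : Type*} [CommRing A] [Algebra ℚ A] [IsAddTorsionFree A]
    {C H : A⟦X⟧} (hC : PowerSeries.constantCoeff C = 0) (hH : PowerSeries.constantCoeff H = 1)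
    (h : d⁄dX A H = d⁄dX A C * H) : PowerSeries.logOf H = C := by
  have hs : PowerSeries.HasSubst (H - 1) :=
    PowerSeries.HasSubst.of_constantCoeff_zero' (by simp [hH])
  refine PowerSeries.derivative.ext ?_ (by rw [PowerSeries.constantCoeff_logOf hH, hC])
  -- The derivative of the logarithm is the geometric series; substituting `H - 1` turns this into
  -- `log'(H - 1) * H = 1`, which cancels the factor `H` in `h`.
  have h1 : d⁄dX A (PowerSeries.log A) * (1 + PowerSeries.X) = 1 := by
    rw [PowerSeries.deriv_log]
    ext n
    rw [mul_add, mul_one, map_add]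
    cases n with
    | zero => simp
    | succ n =>
      rw [PowerSeries.coeff_succ_mul_X]
      simp [pow_succ, PowerSeries.coeff_one]
  have h2 := congrArg (PowerSeries.subst (H - 1)) h1
  have h3 : PowerSeries.subst (H - 1) (1 : A⟦X⟧) = 1 := by
    rw [← PowerSeries.coe_substAlgHom hs, map_one]
  rw [PowerSeries.subst_mul hs, PowerSeries.subst_add hs, PowerSeries.subst_X hs, h3,
    add_sub_cancel] at h2
  rw [PowerSeries.logOf_eq, PowerSeries.derivative_subst hs]
  have h4 : d⁄dX A (H - 1) = d⁄dX A H := by simp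
  rw [h4, h]
  linear_combination (d⁄dX A C) * h2

/-- The logarithm of `D ⊙ (D / g)`, read off from recursions for the coefficients. -/
theorem logOf_hadamard_quotient {d g c e : ℕ → ℚ[X]} (hg : IsUnit (egf g)) (hg0 : g 0 = 1)
    (hc0 : c 0 = 0) (he0 : e 0 = 1)
    (he : ∀ n, e (n + 1) = ∑ ij ∈ Finset.HasAntidiagonal.antidiagonal n,
      (n.choose ij.1 : ℚ) • (c (ij.1 + 1) * e ij.2))
    (r : ℕ → ℕ → ℚ[X])
    (hr : ∀ i j, d (i + j) = d i * r i j)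
    (hd : ∀ n, d n * d n = ∑ ij ∈ Finset.HasAntidiagonal.antidiagonal n,
      (n.choose ij.1 : ℚ) • (e ij.1 * (r ij.1 ij.2 * g ij.2))) (hr0 : ∀ i, r i 0 = 1) :
    PowerSeries.logOf (hadamard (egf d) (egf d * Ring.inverse (egf g))) = egf c := by
  obtain ⟨q, hq⟩ := exists_eq_egf (egf d * Ring.inverse (egf g))
  have hqg : egf d = egf q * egf g := by
    rw [← hq, mul_assoc, Ring.inverse_mul_cancel _ hg, mul_one]
  rw [egf_mul] at hqg
  have hqn := congrFun (egf_injective hqg)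
  -- Both expansions of `d n * d n` agree in every term with `ij.1 < n`, by induction and `d n = d i
  -- * r i j`. Only the terms at `(n, 0)` remain, so nothing is divided by `d n`.
  have hde : ∀ n, d n * q n = e n := by
    intro n
    induction n using Nat.strong_induction_on with
    | _ n ih =>
      have h1 := hd n
      nth_rw 2 [hqn n] at h1
      rw [Finset.mul_sum] at h1
      have hmem : ((n, 0) : ℕ × ℕ) ∈ Finset.HasAntidiagonal.antidiagonal n := by simp
      rw [← Finset.add_sum_erase _ _ hmem, ← Finset.add_sum_erase _ _ hmem] at h1
      have h2 : ∑ x ∈ (Finset.HasAntidiagonal.antidiagonal n).erase (n, 0),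
          d n * ((n.choose x.1 : ℚ) • (q x.1 * g x.2)) =
          ∑ x ∈ (Finset.HasAntidiagonal.antidiagonal n).erase (n, 0),
          (n.choose x.1 : ℚ) • (e x.1 * (r x.1 x.2 * g x.2)) := by
        refine Finset.sum_congr rfl fun x hx => ?_
        obtain ⟨hx1, hx2⟩ := Finset.mem_erase.mp hx
        obtain rfl := Finset.HasAntidiagonal.mem_antidiagonal.mp hx2
        have hlt : x.1 < x.1 + x.2 := by
          rcases Nat.eq_zero_or_pos x.2 with h0 | h0
          · exact absurd (Prod.ext (by simp [h0]) h0) hx1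
          · omega
        rw [← ih _ hlt, hr x.1 x.2, mul_smul_comm]
        congr 1
        ring
      rw [h2] at h1
      have h3 := add_right_cancel h1
      simpa [hr0, hg0] using h3
  have hH : hadamard (egf d) (egf d * Ring.inverse (egf g)) = egf e := by
    rw [hq, hadamard_egf]
    exact congrArg egf (funext hde)
  rw [hH]
  refine logOf_eq_of_derivative_eq (by rw [constantCoeff_egf, hc0])
    (by rw [constantCoeff_egf, he0]) ?_
  rw [derivative_egf, derivative_egf, egf_mul]
  exact congrArg egf (funext he)

/-! ### Reachability in implication digraphs -/

variable {n : ℕ}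

@[simp] theorem Literal.neg_neg (x : Literal n) : x.neg.neg = x := by
  simp [Literal.neg]

@[simp] theorem Literal.neg_fst (x : Literal n) : x.neg.1 = x.1 := rfl

theorem Literal.neg_eq_iff {x y : Literal n} : x.neg = y ↔ x = y.neg := by
  constructor <;> rintro rfl <;> simp

theorem Literal.eq_or_eq_neg {x y : Literal n} (h : x.1 = y.1) : x = y ∨ x = y.neg := by
  obtain ⟨i, b⟩ := x
  obtain ⟨j, c⟩ := y
  simp only at h
  subst h
  cases b <;> cases c <;> simp [Literal.neg]

/-- Reachability in the implication digraph of a set of clauses. -/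
abbrev Implies (F : Finset (Sym2 (Literal n))) (u v : Literal n) : Prop :=
  Reachable (implicationDigraph F) u v

theorem Implies.of_mem {F : Finset (Sym2 (Literal n))} {u v : Literal n}
    (h : s(u.neg, v) ∈ F) : Implies F u v :=
  Relation.ReflTransGen.single h

theorem Implies.trans {F : Finset (Sym2 (Literal n))} {u v w : Literal n}
    (h : Implies F u v) (h' : Implies F v w) : Implies F u w :=
  Relation.ReflTransGen.trans h h'

theorem Implies.refl (F : Finset (Sym2 (Literal n))) (u : Literal n) : Implies F u u :=
  Relation.ReflTransGen.refl

theorem Implies.mono {F F' : Finset (Sym2 (Literal n))} (hF : F ⊆ F') {u v : Literal n}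
    (h : Implies F u v) : Implies F' u v :=
  Relation.ReflTransGen.mono (fun _ _ hab => hF hab) _ _ h

theorem mem_contrapositive {F : Finset (Sym2 (Literal n))} {u v : Literal n}
    (h : s(u.neg, v) ∈ F) : s(v.neg.neg, u.neg) ∈ F := by
  rwa [Literal.neg_neg, Sym2.eq_swap]

theorem Implies.contrapositive {F : Finset (Sym2 (Literal n))} {u v : Literal n}
    (h : Implies F u v) : Implies F v.neg u.neg := by
  induction h with
  | refl => exact Implies.refl _ _
  | tail _ hbc ih => exact (Implies.of_mem (mem_contrapositive hbc)).trans ih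

/-- A set of literals that contains every successor of each of its elements. -/
def SuccClosed (F : Finset (Sym2 (Literal n))) (T : Finset (Literal n)) : Prop :=
  ∀ x y, s(x.neg, y) ∈ F → x ∈ T → y ∈ T

theorem SuccClosed.mem_of_implies {F : Finset (Sym2 (Literal n))} {T : Finset (Literal n)}
    (hT : SuccClosed F T) {x y : Literal n} (h : Implies F x y) (hx : x ∈ T) : y ∈ T := by
  induction h with
  | refl => exact hx
  | tail _ hbc ih => exact hT _ _ hbc ih

/-- A set of literals without complementary pairs. -/
def Consistent (T : Finset (Literal n)) : Prop :=
  ∀ x ∈ T, x.neg ∉ T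

/-- The variables of a set of literals. -/
def vars (T : Finset (Literal n)) : Finset (Fin n) :=
  T.image Prod.fst

theorem mem_vars {T : Finset (Literal n)} {i : Fin n} : i ∈ vars T ↔ ∃ x ∈ T, x.1 = i := by
  simp [vars]

theorem fst_mem_vars {T : Finset (Literal n)} {x : Literal n} :
    x.1 ∈ vars T ↔ x ∈ T ∨ x.neg ∈ T := by
  rw [mem_vars]
  constructor
  · rintro ⟨y, hy, hyx⟩
    rcases Literal.eq_or_eq_neg hyx with rfl | rfl
    · exact Or.inl hy
    · exact Or.inr hy
  · rintro (h | h)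
    · exact ⟨x, h, rfl⟩
    · exact ⟨x.neg, h, rfl⟩

/-- The clauses with two distinct variables from `A`. -/
def clauses (A : Finset (Fin n)) : Finset (Sym2 (Literal n)) :=
  Finset.univ.filter fun c => ¬ (c.map Prod.fst).IsDiag ∧ ∀ x ∈ c, x.1 ∈ A

theorem mk_mem_clauses {A : Finset (Fin n)} {k l : Literal n} :
    s(k, l) ∈ clauses A ↔ k.1 ≠ l.1 ∧ k.1 ∈ A ∧ l.1 ∈ A := by
  rw [clauses, Finset.mem_filter, Sym2.map_mk, Sym2.mk_isDiag_iff]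
  simp only [Finset.mem_univ, true_and, Sym2.mem_iff, forall_eq_or_imp, forall_eq, ne_eq]

theorem clauses_mono {A B : Finset (Fin n)} (h : A ⊆ B) : clauses A ⊆ clauses B := by
  intro c
  induction c with
  | _ k l =>
    rw [mk_mem_clauses, mk_mem_clauses]
    exact fun ⟨h1, h2, h3⟩ => ⟨h1, h h2, h h3⟩

theorem clauses_inter (A B : Finset (Fin n)) : clauses A ∩ clauses B = clauses (A ∩ B) := by
  ext c
  induction c with
  | _ k l =>
    simp only [Finset.mem_inter, mk_mem_clauses]
    tauto

theorem clauses_empty : clauses (∅ : Finset (Fin n)) = ∅ := by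
  ext c
  induction c with
  | _ k l => simp [mk_mem_clauses]

theorem disjoint_clauses {A B : Finset (Fin n)} (h : Disjoint A B) :
    Disjoint (clauses A) (clauses B) := by
  rw [Finset.disjoint_iff_inter_eq_empty, clauses_inter, Finset.disjoint_iff_inter_eq_empty.mp h,
    clauses_empty]

theorem mem_clauses_of_arc {A : Finset (Fin n)} {F : Finset (Sym2 (Literal n))}
    (hF : F ⊆ clauses A) {u v : Literal n} (h : s(u.neg, v) ∈ F) :
    u.1 ≠ v.1 ∧ u.1 ∈ A ∧ v.1 ∈ A :=
  mk_mem_clauses (k := u.neg).mp (hF h)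

theorem Implies.fst_mem {A : Finset (Fin n)} {F : Finset (Sym2 (Literal n))}
    (hF : F ⊆ clauses A) {u v : Literal n} (h : Implies F u v) (hu : u.1 ∈ A) : v.1 ∈ A := by
  induction h with
  | refl => exact hu
  | tail _ hbc _ => exact (mem_clauses_of_arc hF hbc).2.2

theorem Implies.eq_of_notMem {A : Finset (Fin n)} {F : Finset (Sym2 (Literal n))}
    (hF : F ⊆ clauses A) {u v : Literal n} (h : Implies F u v) (hu : u.1 ∉ A) : u = v := by
  induction h with
  | refl => rfl
  | tail _ hbc ih =>
    subst ih
    exact absurd (mem_clauses_of_arc hF hbc).2.1 hu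

/-- A path that starts outside `B` never enters `B`, so it has no opportunity to use a clause of
`F'`. -/
theorem implies_union_iff {B : Finset (Fin n)} {F F' : Finset (Sym2 (Literal n))}
    (hF : ∀ u v : Literal n, u.1 ∉ B → s(u.neg, v) ∈ F → v.1 ∉ B) (hF' : F' ⊆ clauses B)
    {u v : Literal n} (hu : u.1 ∉ B) :
    Implies (F ∪ F') u v ↔ Implies F u v := by
  refine ⟨fun h => ?_, fun h => h.mono Finset.subset_union_left⟩
  have : Implies F u v ∧ v.1 ∉ B := by
    induction h with
    | refl => exact ⟨Implies.refl _ _, hu⟩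
    | tail _ hbc ih =>
      rcases Finset.mem_union.mp hbc with h1 | h1
      · exact ⟨ih.1.trans (Implies.of_mem h1), hF _ _ ih.2 h1⟩
      · exact absurd (mem_clauses_of_arc hF' h1).2.1 ih.2
  exact this.1

theorem implies_union_left {A B : Finset (Fin n)} (hAB : Disjoint A B)
    {F F' : Finset (Sym2 (Literal n))} (hF : F ⊆ clauses A) (hF' : F' ⊆ clauses B)
    {u v : Literal n} (hu : u.1 ∉ B) :
    Implies (F ∪ F') u v ↔ Implies F u v :=
  implies_union_iff (fun _ _ _ h =>
    Finset.disjoint_left.mp hAB (mem_clauses_of_arc hF h).2.2) hF' hu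

theorem implies_union_right {A B : Finset (Fin n)} (hAB : Disjoint A B)
    {F F' : Finset (Sym2 (Literal n))} (hF : F ⊆ clauses A) (hF' : F' ⊆ clauses B)
    {u v : Literal n} (hu : u.1 ∉ A) :
    Implies (F ∪ F') u v ↔ Implies F' u v := by
  rw [Finset.union_comm]
  exact implies_union_left hAB.symm hF' hF hu

/-! ### The signed weight -/

/-- There are no arcs between the strongly connected components of the implication digraph. -/
def Isolated (F : Finset (Sym2 (Literal n))) : Prop :=
  ∀ u v, Implies F u v → Implies F v u

theorem isContradictoryVariable_iff {F : Finset (Sym2 (Literal n))} (x : Literal n) :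
    IsContradictoryVariable F x.1 ↔ Implies F x x.neg ∧ Implies F x.neg x := by
  obtain ⟨i, b⟩ := x
  cases b
  · exact and_comm
  · exact Iff.rfl

open Classical in
/-- The variables whose literals can be reached from a literal of the variable `i`. -/
def variableClass (F : Finset (Sym2 (Literal n))) (i : Fin n) : Finset (Fin n) :=
  Finset.univ.filter fun j => Implies F (i, true) (j, true) ∨ Implies F (i, true) (j, false)

theorem mem_variableClass_iff {F : Finset (Sym2 (Literal n))} {i j : Fin n} :
    j ∈ variableClass F i ↔ ∃ y : Literal n, y.1 = j ∧ Implies F (i, true) y := by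
  simp only [variableClass, Finset.mem_filter]
  constructor
  · rintro ⟨_, h | h⟩
    exacts [⟨_, rfl, h⟩, ⟨_, rfl, h⟩]
  · rintro ⟨⟨k, b⟩, rfl, h⟩
    cases b
    exacts [⟨Finset.mem_univ _, Or.inr h⟩, ⟨Finset.mem_univ _, Or.inl h⟩]

/-- The class is defined from the positive literal. With isolation, a path from `x` to `y` can be
reversed and then contraposed into a path from `x.neg` to `y.neg`, so either literal may serve as
the start. -/
theorem Isolated.mem_variableClass {F : Finset (Sym2 (Literal n))} (hF : Isolated F)
    (x : Literal n) {j : Fin n} :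
    j ∈ variableClass F x.1 ↔ ∃ y : Literal n, y.1 = j ∧ Implies F x y := by
  rw [mem_variableClass_iff]
  obtain ⟨i, b⟩ := x
  cases b
  · constructor <;> rintro ⟨y, rfl, h⟩
    · exact ⟨y.neg, rfl, (hF _ _ h).contrapositive⟩
    · exact ⟨y.neg, rfl, (hF _ _ h).contrapositive⟩
  · rfl

theorem self_mem_variableClass (F : Finset (Sym2 (Literal n))) (i : Fin n) :
    i ∈ variableClass F i :=
  mem_variableClass_iff.mpr ⟨(i, true), rfl, Implies.refl _ _⟩

theorem variableClass_subset {A : Finset (Fin n)} {F : Finset (Sym2 (Literal n))}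
    (hF : F ⊆ clauses A) {i : Fin n} (hi : i ∈ A) : variableClass F i ⊆ A := by
  intro j hj
  obtain ⟨y, rfl, h⟩ := mem_variableClass_iff.mp hj
  exact h.fst_mem hF hi

open Classical in
/-- The variable sets of the pairs of ordinary strongly connected components, for a set of clauses
with variables from `A` whose components are isolated. -/
def ordinaryClasses (A : Finset (Fin n)) (F : Finset (Sym2 (Literal n))) :
    Finset (Finset (Fin n)) :=
  (A.filter fun i => ¬ IsContradictoryVariable F i).image (variableClass F)

open Classical in
/-- The weight of a set of clauses with variables from `A`: it vanishes unless the components are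
isolated, and each pair of ordinary components contributes a factor `-1`. -/
def signedWeight (A : Finset (Fin n)) (F : Finset (Sym2 (Literal n))) : ℚ[X] :=
  if Isolated F then (-1) ^ (ordinaryClasses A F).card else 0

/-! ### Multiplicativity over disjoint sets of variables -/

section Union

variable {A B : Finset (Fin n)} {F F' : Finset (Sym2 (Literal n))}

theorem isolated_union_iff (hAB : Disjoint A B) (hF : F ⊆ clauses A) (hF' : F' ⊆ clauses B) :
    Isolated (F ∪ F') ↔ Isolated F ∧ Isolated F' := by
  constructor
  · intro h
    constructor <;> intro u v huv
    · by_cases hu : u.1 ∈ A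
      · have hv := huv.fst_mem hF hu
        exact (implies_union_left hAB hF hF' (Finset.disjoint_left.mp hAB hv)).mp
          (h _ _ (huv.mono Finset.subset_union_left))
      · rw [huv.eq_of_notMem hF hu]
        exact Implies.refl _ _
    · by_cases hu : u.1 ∈ B
      · have hv := huv.fst_mem hF' hu
        exact (implies_union_right hAB hF hF' (Finset.disjoint_right.mp hAB hv)).mp
          (h _ _ (huv.mono Finset.subset_union_right))
      · rw [huv.eq_of_notMem hF' hu]
        exact Implies.refl _ _
  · rintro ⟨h, h'⟩ u v huv
    by_cases hu : u.1 ∈ B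
    · have hu' := Finset.disjoint_right.mp hAB hu
      exact (h' _ _ ((implies_union_right hAB hF hF' hu').mp huv)).mono
        Finset.subset_union_right
    · exact (h _ _ ((implies_union_left hAB hF hF' hu).mp huv)).mono Finset.subset_union_left

theorem isContradictoryVariable_union_left (hAB : Disjoint A B) (hF : F ⊆ clauses A)
    (hF' : F' ⊆ clauses B) {i : Fin n} (hi : i ∉ B) :
    IsContradictoryVariable (F ∪ F') i ↔ IsContradictoryVariable F i :=
  and_congr (implies_union_left hAB hF hF' hi) (implies_union_left hAB hF hF' hi)

theorem variableClass_union_left (hAB : Disjoint A B) (hF : F ⊆ clauses A)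
    (hF' : F' ⊆ clauses B) {i : Fin n} (hi : i ∉ B) :
    variableClass (F ∪ F') i = variableClass F i := by
  ext j
  rw [mem_variableClass_iff, mem_variableClass_iff]
  exact exists_congr fun y => and_congr_right fun _ => implies_union_left hAB hF hF' hi

theorem ordinaryClasses_union_left (hAB : Disjoint A B) (hF : F ⊆ clauses A)
    (hF' : F' ⊆ clauses B) : ordinaryClasses A (F ∪ F') = ordinaryClasses A F := by
  ext C
  simp only [ordinaryClasses, Finset.mem_image, Finset.mem_filter]
  refine exists_congr fun i => ?_
  rw [and_assoc, and_assoc]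
  refine and_congr_right fun hi => ?_
  have hi' := Finset.disjoint_left.mp hAB hi
  rw [isContradictoryVariable_union_left hAB hF hF' hi', variableClass_union_left hAB hF hF' hi']

theorem disjoint_ordinaryClasses (hAB : Disjoint A B) (hF' : F' ⊆ clauses B) :
    Disjoint (ordinaryClasses A F) (ordinaryClasses B F') := by
  rw [Finset.disjoint_left]
  intro C hC hC'
  simp only [ordinaryClasses, Finset.mem_image, Finset.mem_filter] at hC hC'
  obtain ⟨i, ⟨hi, _⟩, rfl⟩ := hC
  obtain ⟨j, ⟨hj, _⟩, hij⟩ := hC'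
  have h := variableClass_subset hF' hj
  rw [hij] at h
  exact Finset.disjoint_left.mp hAB hi (h (self_mem_variableClass F i))

theorem signedWeight_union (hAB : Disjoint A B) (hF : F ⊆ clauses A) (hF' : F' ⊆ clauses B) :
    signedWeight (A ∪ B) (F ∪ F') = signedWeight A F * signedWeight B F' := by
  classical
  have h : ordinaryClasses (A ∪ B) (F ∪ F') = ordinaryClasses A F ∪ ordinaryClasses B F' := by
    rw [← ordinaryClasses_union_left hAB hF hF', ← ordinaryClasses_union_left hAB.symm hF' hF,
      Finset.union_comm F' F]
    simp only [ordinaryClasses, Finset.filter_union, Finset.image_union]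
  simp only [signedWeight]
  rw [isolated_union_iff hAB hF hF', h,
    Finset.card_union_of_disjoint (disjoint_ordinaryClasses hAB hF'), pow_add]
  by_cases h1 : Isolated F <;> by_cases h2 : Isolated F' <;> simp [h1, h2]

end Union

/-- An arc `u → v` has the return path `v → ¬v → ¬u → u`, so the components are isolated, and none
of those on `A` is ordinary. -/
theorem signedWeight_of_contradictory {A : Finset (Fin n)} {F : Finset (Sym2 (Literal n))}
    (hF : F ⊆ clauses A) (h : ∀ i ∈ A, IsContradictoryVariable F i) : signedWeight A F = 1 := by
  classical
  have hiso : Isolated F := by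
    intro u v huv
    by_cases hu : u.1 ∈ A
    · have hv := huv.fst_mem hF hu
      have hu' := (isContradictoryVariable_iff u).mp (h _ hu)
      have hv' := (isContradictoryVariable_iff v).mp (h _ hv)
      exact hv'.1.trans (huv.contrapositive.trans hu'.2)
    · rw [huv.eq_of_notMem hF hu]
      exact Implies.refl _ _
  have hA : (A.filter fun i => ¬ IsContradictoryVariable F i) = ∅ :=
    Finset.filter_eq_empty_iff.mpr fun i hi => not_not.mpr (h i hi)
  simp [signedWeight, hiso, ordinaryClasses, hA]

/-- The set of the negations of the elements of a set of literals. -/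
def negSet (T : Finset (Literal n)) : Finset (Literal n) :=
  T.image Literal.neg

theorem mem_negSet {T : Finset (Literal n)} {x : Literal n} : x ∈ negSet T ↔ x.neg ∈ T := by
  rw [negSet, Finset.mem_image]
  exact ⟨fun ⟨y, hy, h⟩ => by rwa [← h, Literal.neg_neg], fun h => ⟨_, h, Literal.neg_neg x⟩⟩

/-- Closure of both `X` and its negation rules out arcs between them, so they form exactly one
ordinary pair and the exponent of `-1` is one. -/
theorem signedWeight_of_ordinary {X : Finset (Literal n)} {F : Finset (Sym2 (Literal n))}
    (hX : X.Nonempty) (hcons : Consistent X) (hF : F ⊆ clauses (vars X)) (hcl : SuccClosed F X)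
    (hcl' : SuccClosed F (negSet X)) (hconn : ∀ u ∈ X, ∀ v ∈ X, Implies F u v) :
    signedWeight (vars X) F = -1 := by
  classical
  have hiso : Isolated F := by
    intro u v huv
    by_cases hu : u.1 ∈ vars X
    · rcases fst_mem_vars.mp hu with h | h
      · exact hconn _ (hcl.mem_of_implies huv h) _ h
      · have hv := mem_negSet.mp (hcl'.mem_of_implies huv (mem_negSet.mpr h))
        simpa using (hconn _ h _ hv).contrapositive
    · rw [huv.eq_of_notMem hF hu]
      exact Implies.refl _ _
  have hord : (vars X).filter (fun i => ¬ IsContradictoryVariable F i) = vars X := by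
    refine Finset.filter_true_of_mem fun i hi => ?_
    obtain ⟨x, hx, rfl⟩ := mem_vars.mp hi
    rw [isContradictoryVariable_iff]
    exact fun h => hcons x hx (hcl.mem_of_implies h.1 hx)
  have hclass : ∀ i ∈ vars X, variableClass F i = vars X := by
    intro i hi
    refine (variableClass_subset hF hi).antisymm fun j hj => ?_
    obtain ⟨x, hx, rfl⟩ := mem_vars.mp hi
    obtain ⟨y, hy, rfl⟩ := mem_vars.mp hj
    exact (hiso.mem_variableClass x).mpr ⟨y, rfl, hconn _ hx _ hy⟩
  have himg : ordinaryClasses (vars X) F = {vars X} := by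
    rw [ordinaryClasses, hord]
    ext C
    rw [Finset.mem_image, Finset.mem_singleton]
    constructor
    · rintro ⟨i, hi, rfl⟩
      exact hclass i hi
    · rintro rfl
      obtain ⟨x, hx⟩ := hX
      exact ⟨x.1, mem_vars.mpr ⟨x, hx, rfl⟩, hclass _ (mem_vars.mpr ⟨x, hx, rfl⟩)⟩
  simp [signedWeight, hiso, himg]

/-! ### The signed count of closed partial assignments -/

theorem vars_union (S T : Finset (Literal n)) : vars (S ∪ T) = vars S ∪ vars T :=
  Finset.image_union _ _

theorem vars_negSet (T : Finset (Literal n)) : vars (negSet T) = vars T := by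
  ext i
  simp only [mem_vars]
  constructor
  · rintro ⟨x, hx, rfl⟩
    exact ⟨_, mem_negSet.mp hx, rfl⟩
  · rintro ⟨x, hx, rfl⟩
    exact ⟨x.neg, mem_negSet.mpr (by simpa using hx), rfl⟩

theorem Consistent.negSet {T : Finset (Literal n)} (hT : Consistent T) :
    Consistent (negSet T) := by
  intro x hx hx'
  rw [mem_negSet] at hx hx'
  exact hT _ hx hx'

open Classical in
/-- The partial assignments of the variables in `A`, as sets of literals. -/
def partials (A : Finset (Fin n)) : Finset (Finset (Literal n)) :=
  Finset.univ.filter fun T => Consistent T ∧ vars T ⊆ A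

theorem mem_partials {A : Finset (Fin n)} {T : Finset (Literal n)} :
    T ∈ partials A ↔ Consistent T ∧ vars T ⊆ A := by
  simp [partials]

theorem partials_mono {A B : Finset (Fin n)} (h : A ⊆ B) : partials A ⊆ partials B := by
  intro T
  rw [mem_partials, mem_partials]
  exact fun hT => ⟨hT.1, hT.2.trans h⟩

/-- A consistent `T` containing `Y` has no further literals on the variables of `Y`, so removing `Y`
loses nothing. -/
theorem sum_partials_of_superset {M : Type*} [AddCommMonoid M] {A : Finset (Fin n)}
    {Y : Finset (Literal n)} (hY : Y ∈ partials A) (f : Finset (Literal n) → M) :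
    ∑ T ∈ (partials A).filter (Y ⊆ ·), f T = ∑ T ∈ partials (A \ vars Y), f (T ∪ Y) := by
  obtain ⟨hYc, hYA⟩ := mem_partials.mp hY
  refine Finset.sum_nbij' (· \ Y) (· ∪ Y) ?_ ?_ ?_ ?_ ?_
  · intro T hT
    obtain ⟨hT, hYT⟩ := Finset.mem_filter.mp hT
    obtain ⟨hTc, hTA⟩ := mem_partials.mp hT
    refine mem_partials.mpr ⟨fun x hx hx' => hTc x (Finset.mem_sdiff.mp hx).1
      (Finset.mem_sdiff.mp hx').1, fun i hi => ?_⟩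
    obtain ⟨x, hx, rfl⟩ := mem_vars.mp hi
    obtain ⟨hxT, hxY⟩ := Finset.mem_sdiff.mp hx
    refine Finset.mem_sdiff.mpr ⟨hTA (mem_vars.mpr ⟨x, hxT, rfl⟩), fun h => ?_⟩
    rcases fst_mem_vars.mp h with h | h
    · exact hxY h
    · exact hTc x hxT (hYT h)
  · intro T hT
    obtain ⟨hTc, hTA⟩ := mem_partials.mp hT
    have hdis : ∀ x ∈ T, x.1 ∉ vars Y := fun x hx =>
      (Finset.mem_sdiff.mp (hTA (mem_vars.mpr ⟨x, hx, rfl⟩))).2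
    refine Finset.mem_filter.mpr ⟨mem_partials.mpr ⟨?_, ?_⟩, Finset.subset_union_right⟩
    · intro x hx hx'
      rcases Finset.mem_union.mp hx with h | h <;> rcases Finset.mem_union.mp hx' with h' | h'
      · exact hTc x h h'
      · exact hdis x h (fst_mem_vars.mpr (Or.inr h'))
      · exact hdis _ h' (fst_mem_vars.mpr (Or.inr (by simpa using h)))
      · exact hYc x h h'
    · rw [vars_union]
      exact Finset.union_subset (hTA.trans Finset.sdiff_subset) hYA
  · intro T hT
    exact Finset.sdiff_union_of_subset (Finset.mem_filter.mp hT).2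
  · intro T hT
    refine Finset.union_sdiff_cancel_right (Finset.disjoint_left.mpr fun x hx hxY => ?_)
    exact (Finset.mem_sdiff.mp ((mem_partials.mp hT).2 (mem_vars.mpr ⟨x, hx, rfl⟩))).2
      (mem_vars.mpr ⟨x, hxY, rfl⟩)
  · intro T hT
    rw [Finset.sdiff_union_of_subset (Finset.mem_filter.mp hT).2]

/-- The hypothesis on `f` is what closed assignments satisfy when `X` is strongly connected. Since
`X` is nonempty, a consistent set cannot contain both `X` and its negation, so the three cases
exclude each other. -/
theorem sum_partials_split {M : Type*} [AddCommMonoid M] {A : Finset (Fin n)}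
    {X : Finset (Literal n)} (hX : X ∈ partials A) (hne : X.Nonempty)
    (f : Finset (Literal n) → M)
    (hf : ∀ T, f T ≠ 0 → Disjoint (vars T) (vars X) ∨ X ⊆ T ∨ negSet X ⊆ T) :
    ∑ T ∈ partials A, f T = ∑ T ∈ partials (A \ vars X), f (T ∪ X) +
      (∑ T ∈ partials (A \ vars X), f (T ∪ negSet X) + ∑ T ∈ partials (A \ vars X), f T) := by
  classical
  obtain ⟨hXc, hXA⟩ := mem_partials.mp hX
  have hX' : negSet X ∈ partials A :=
    mem_partials.mpr ⟨hXc.negSet, by rwa [vars_negSet]⟩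
  obtain ⟨z, hz⟩ := hne
  have hz' : z.neg ∈ negSet X := mem_negSet.mpr (by simpa using hz)
  rw [← sum_partials_of_superset hX, ← vars_negSet X, ← sum_partials_of_superset hX',
    vars_negSet X, ← Finset.sum_filter_add_sum_filter_not (partials A) (X ⊆ ·)]
  congr 1
  rw [← Finset.sum_filter_add_sum_filter_not _ (negSet X ⊆ ·), Finset.filter_filter]
  congr 1
  · refine Finset.sum_congr (Finset.filter_congr fun T hT => ?_) fun _ _ => rfl
    refine and_iff_right_of_imp fun h h' => ?_
    exact (mem_partials.mp hT).1 z (h' hz) (h hz')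
  · symm
    refine Finset.sum_subset (fun T hT => ?_) fun T hT hT' => ?_
    · obtain ⟨hTc, hTA⟩ := mem_partials.mp hT
      have hd : ∀ x ∈ T, x.1 ∉ vars X := fun x hx =>
        (Finset.mem_sdiff.mp (hTA (mem_vars.mpr ⟨x, hx, rfl⟩))).2
      refine Finset.mem_filter.mpr ⟨Finset.mem_filter.mpr
        ⟨partials_mono Finset.sdiff_subset hT, fun h => ?_⟩, fun h => ?_⟩
      · exact hd z (h hz) (mem_vars.mpr ⟨z, hz, rfl⟩)
      · exact hd z.neg (h hz') (mem_vars.mpr ⟨z, hz, rfl⟩)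
    · by_contra hne
      obtain ⟨hT1, hT2⟩ := Finset.mem_filter.mp hT
      obtain ⟨hT1, hT3⟩ := Finset.mem_filter.mp hT1
      rcases hf T hne with h | h | h
      · obtain ⟨hTc, hTA⟩ := mem_partials.mp hT1
        exact hT' (mem_partials.mpr ⟨hTc, Finset.subset_sdiff.mpr ⟨hTA, h⟩⟩)
      · exact hT3 h
      · exact hT2 h

/-- A sink of the condensation of the implication digraph that is consistent. -/
theorem exists_sink {A : Finset (Fin n)} {F : Finset (Sym2 (Literal n))} (hF : F ⊆ clauses A)
    {i : Fin n} (hi : i ∈ A) (hc : ¬ IsContradictoryVariable F i) :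
    ∃ X ∈ partials A, X.Nonempty ∧ SuccClosed F X ∧ ∀ u ∈ X, ∀ v ∈ X, Implies F u v := by
  classical
  obtain ⟨y, hy, hyn⟩ : ∃ y : Literal n, y.1 ∈ A ∧ ¬ Implies F y y.neg := by
    rcases not_and_or.mp hc with h | h
    exacts [⟨(i, true), hi, h⟩, ⟨(i, false), hi, h⟩]
  let succs : Literal n → Finset (Literal n) := fun z => Finset.univ.filter (Implies F z)
  have mem_succs : ∀ {z v}, v ∈ succs z ↔ Implies F z v := by simp [succs]
  -- Among the literals reachable from `y`, one with fewest successors lies in a sink component, and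
  -- its successors are that component.
  obtain ⟨z, hz, hmin⟩ := Finset.exists_min_image (succs y) (fun v => (succs v).card)
    ⟨y, mem_succs.mpr (Implies.refl _ _)⟩
  have hyz := mem_succs.mp hz
  have hback : ∀ v ∈ succs z, Implies F v z := by
    intro v hv
    have hv' := mem_succs.mp hv
    have hsub : succs v ⊆ succs z := fun w hw =>
      mem_succs.mpr (hv'.trans (mem_succs.mp hw))
    have heq := Finset.eq_of_subset_of_card_le hsub (hmin v (mem_succs.mpr (hyz.trans hv')))
    exact mem_succs.mp (heq ▸ mem_succs.mpr (Implies.refl _ _))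
  refine ⟨succs z, mem_partials.mpr ⟨?_, ?_⟩, ⟨z, mem_succs.mpr (Implies.refl _ _)⟩, ?_, ?_⟩
  · intro u hu hu'
    -- If `z` implied both `u` and `¬u`, then `y → z → u → ¬z → ¬y`, against the choice of `y`.
    have h1 : Implies F u z.neg := by simpa using (mem_succs.mp hu').contrapositive
    exact hyn (hyz.trans ((mem_succs.mp hu).trans (h1.trans hyz.contrapositive)))
  · intro j hj
    obtain ⟨x, hx, rfl⟩ := mem_vars.mp hj
    exact (hyz.trans (mem_succs.mp hx)).fst_mem hF hy
  · intro u v huv hu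
    exact mem_succs.mpr ((mem_succs.mp hu).trans (Implies.of_mem huv))
  · intro u hu v hv
    exact (hback u hu).trans (mem_succs.mp hv)

/-- The clauses of `F` with variables from `A`. -/
abbrev restrict (F : Finset (Sym2 (Literal n))) (A : Finset (Fin n)) :
    Finset (Sym2 (Literal n)) :=
  F ∩ clauses A

open Classical in
/-- The weight of what a partial assignment leaves unassigned, if it is closed. -/
def residualWeight (A : Finset (Fin n)) (F : Finset (Sym2 (Literal n)))
    (T : Finset (Literal n)) : ℚ[X] :=
  if SuccClosed F T then signedWeight (A \ vars T) (restrict F (A \ vars T)) else 0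

theorem mk_mem_restrict {F : Finset (Sym2 (Literal n))} {A : Finset (Fin n)}
    {k l : Literal n} :
    s(k, l) ∈ restrict F A ↔ s(k, l) ∈ F ∧ k.1 ≠ l.1 ∧ k.1 ∈ A ∧ l.1 ∈ A := by
  rw [restrict, Finset.mem_inter, mk_mem_clauses]

/-! ### Closed assignments relative to a sink component -/

section Sink

variable {A : Finset (Fin n)} {F : Finset (Sym2 (Literal n))} {X T : Finset (Literal n)}

theorem SuccClosed.not_mem_neg_of_arc (hT : SuccClosed F T) {x y : Literal n}
    (h : s(x.neg, y) ∈ F) (hy : y.neg ∈ T) : x.neg ∈ T :=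
  hT _ _ (mem_contrapositive h) hy

/-- No arc leaves `X`, and by contraposition none enters `negSet X` from outside. Hence an arc out
of `T` ends in `X` or away from its variables, and closedness of `T ∪ X` only concerns clauses
without variables of `X`. -/
theorem residualWeight_union_sink (hF : F ⊆ clauses A) (hX : SuccClosed F X)
    (hT : T ∈ partials (A \ vars X)) :
    residualWeight A F (T ∪ X) = residualWeight (A \ vars X) (restrict F (A \ vars X)) T := by
  obtain ⟨hTc, hTA⟩ := mem_partials.mp hT
  have hTA' : ∀ x ∈ T, x.1 ∈ A \ vars X := fun x hx => hTA (mem_vars.mpr ⟨x, hx, rfl⟩)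
  have hiff : SuccClosed F (T ∪ X) ↔ SuccClosed (restrict F (A \ vars X)) T := by
    constructor
    · intro h x y hxy hx
      obtain ⟨hxyF, -, -, hyA⟩ := mk_mem_restrict.mp hxy
      rcases Finset.mem_union.mp (h x y hxyF (Finset.mem_union_left _ hx)) with hy | hy
      · exact hy
      · exact absurd (mem_vars.mpr ⟨y, hy, rfl⟩) (Finset.mem_sdiff.mp hyA).2
    · intro h x y hxy hx
      rcases Finset.mem_union.mp hx with hx | hx
      · by_cases hy : y.1 ∈ vars X
        · rcases fst_mem_vars.mp hy with hy | hy
          · exact Finset.mem_union_right _ hy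
          · refine absurd ?_ (Finset.mem_sdiff.mp (hTA' x hx)).2
            exact fst_mem_vars.mpr (Or.inr (hX.not_mem_neg_of_arc hxy hy))
        · obtain ⟨h1, -, h3⟩ := mem_clauses_of_arc hF hxy
          exact Finset.mem_union_left _ (h x y (mk_mem_restrict.mpr
            ⟨hxy, h1, hTA' x hx, Finset.mem_sdiff.mpr ⟨h3, hy⟩⟩) hx)
      · exact Finset.mem_union_right _ (hX x y hxy hx)
  have hA : A \ vars (T ∪ X) = (A \ vars X) \ vars T := by
    rw [vars_union, Finset.union_comm, sdiff_sdiff_left, Finset.sup_eq_union]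
  have hr : restrict (restrict F (A \ vars X)) ((A \ vars X) \ vars T) =
      restrict F ((A \ vars X) \ vars T) := by
    rw [restrict, restrict, restrict, Finset.inter_assoc, clauses_inter,
      Finset.inter_eq_right.mpr Finset.sdiff_subset]
  simp only [residualWeight, hA, hr]
  by_cases h : SuccClosed F (T ∪ X)
  · rw [if_pos h, if_pos (hiff.mp h)]
  · rw [if_neg h, if_neg (mt hiff.mpr h)]

/-- For an arc from `x` in `negSet X` to an unassigned `y`, isolation gives a path back. Its
contrapositive runs from `x.neg` in `X` to `y.neg`, and the sink `X` captures `y.neg`. -/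
theorem succClosed_union_negSet (hF : F ⊆ clauses A) (hX : SuccClosed F X)
    (hT : T ∈ partials (A \ vars X)) (hcl : SuccClosed F T)
    (hiso : Isolated (restrict F (A \ vars T))) :
    SuccClosed F (T ∪ negSet X) := by
  obtain ⟨hTc, hTA⟩ := mem_partials.mp hT
  have hdis : ∀ x : Literal n, x.1 ∈ vars T → x.1 ∉ vars X := fun x hx =>
    (Finset.mem_sdiff.mp (hTA hx)).2
  intro x y hxy hx
  rcases Finset.mem_union.mp hx with hx | hx
  · exact Finset.mem_union_left _ (hcl x y hxy hx)
  · have hxX : x.1 ∈ vars X := fst_mem_vars.mpr (Or.inr (mem_negSet.mp hx))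
    by_cases hy : y.1 ∈ vars T
    · rcases fst_mem_vars.mp hy with hy | hy
      · exact Finset.mem_union_left _ hy
      · exact absurd hxX (hdis x (fst_mem_vars.mpr (Or.inr (hcl.not_mem_neg_of_arc hxy hy))))
    · obtain ⟨h1, h2, h3⟩ := mem_clauses_of_arc hF hxy
      have harc : s(x.neg, y) ∈ restrict F (A \ vars T) := mk_mem_restrict.mpr
        ⟨hxy, h1, Finset.mem_sdiff.mpr ⟨h2, fun h => hdis x h hxX⟩, Finset.mem_sdiff.mpr ⟨h3, hy⟩⟩
      have hback := (hiso _ _ (Implies.of_mem harc)).contrapositive.mono Finset.inter_subset_left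
      exact Finset.mem_union_right _
        (mem_negSet.mpr (hX.mem_of_implies hback (mem_negSet.mp hx)))

/-- This is the sign-reversing cancellation. If `T ∪ negSet X` is closed, then `T` leaves the same
problem plus one isolated ordinary pair, worth `-1`. If it is not closed, a closed `T` leaves a
problem with non-isolated components, of weight zero. -/
theorem residualWeight_add_union_negSet (hF : F ⊆ clauses A) (hX : SuccClosed F X)
    (hXp : X ∈ partials A) (hne : X.Nonempty) (hconn : ∀ u ∈ X, ∀ v ∈ X, Implies F u v)
    (hT : T ∈ partials (A \ vars X)) :
    residualWeight A F (T ∪ negSet X) + residualWeight A F T = 0 := by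
  classical
  obtain ⟨hXc, hXA⟩ := mem_partials.mp hXp
  obtain ⟨hTc, hTA⟩ := mem_partials.mp hT
  have hdis : ∀ x : Literal n, x.1 ∈ vars T → x.1 ∉ vars X := fun x hx =>
    (Finset.mem_sdiff.mp (hTA hx)).2
  by_cases h : SuccClosed F (T ∪ negSet X)
  · have hcl : SuccClosed F T := by
      intro x y hxy hx
      rcases Finset.mem_union.mp (h x y hxy (Finset.mem_union_left _ hx)) with hy | hy
      · exact hy
      · exact absurd (fst_mem_vars.mpr (Or.inr (hX.not_mem_neg_of_arc hxy (mem_negSet.mp hy))))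
          (hdis x (mem_vars.mpr ⟨x, hx, rfl⟩))
    have hA : A \ vars T = (A \ vars (T ∪ negSet X)) ∪ vars X := by
      ext i
      rw [vars_union, vars_negSet]
      simp only [Finset.mem_union, Finset.mem_sdiff]
      have h1 : i ∈ vars X → i ∈ A := fun h => hXA h
      have h2 : i ∈ vars T → i ∉ vars X := fun hi => hdis (i, true) hi
      tauto
    have hdis2 : Disjoint (A \ vars (T ∪ negSet X)) (vars X) := by
      rw [vars_union, vars_negSet]
      exact Finset.disjoint_left.mpr fun i hi hi' =>
        (Finset.mem_sdiff.mp hi).2 (Finset.mem_union_right _ hi')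
    -- No clause joins `X` to the remaining unassigned variables: if `u.neg` is in `negSet X` the
    -- arc `u.neg → v` stays in `T ∪ negSet X`, and if it is in `X` the arc stays in the sink.
    have key : ∀ u v : Literal n, s(u, v) ∈ F → u.1 ∈ vars X →
        v.1 ∉ A \ vars (T ∪ negSet X) := by
      intro u v huv hu hv
      have hv' := (Finset.mem_sdiff.mp hv).2
      have huv' : s(u.neg.neg, v) ∈ F := by simpa using huv
      rcases fst_mem_vars.mp hu with hu | hu
      · exact hv' (mem_vars.mpr ⟨v, h u.neg v huv' (Finset.mem_union_right _
          (mem_negSet.mpr (by simpa using hu))), rfl⟩)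
      · rw [vars_union, vars_negSet] at hv'
        exact hv' (Finset.mem_union_right _ (mem_vars.mpr ⟨v, hX u.neg v huv' hu, rfl⟩))
    have hrestr : restrict F (A \ vars T) =
        restrict F (A \ vars (T ∪ negSet X)) ∪ restrict F (vars X) := by
      ext c
      induction c with
      | _ k l =>
        rw [Finset.mem_union, mk_mem_restrict, mk_mem_restrict, mk_mem_restrict, hA,
          Finset.mem_union, Finset.mem_union]
        have h1 := key k l
        have h2 := fun h => key l k (by rwa [Sym2.eq_swap])
        tauto
    have hord : signedWeight (vars X) (restrict F (vars X)) = -1 := by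
      have hclX : SuccClosed (restrict F (vars X)) X := fun x y hxy hx =>
        hX x y (mk_mem_restrict.mp hxy).1 hx
      refine signedWeight_of_ordinary hne hXc Finset.inter_subset_right hclX ?_ ?_
      · intro x y hxy hx
        obtain ⟨hxyF, -, -, hy⟩ := mk_mem_restrict.mp hxy
        rcases Finset.mem_union.mp (h x y hxyF (Finset.mem_union_right _ hx)) with hyT | hyX
        · exact absurd hy (hdis y (mem_vars.mpr ⟨y, hyT, rfl⟩))
        · exact hyX
      · intro u hu v hv
        have huv := hconn u hu v hv
        clear hv
        induction huv with
        | refl => exact Implies.refl _ _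
        | @tail b c hub hbc ih =>
          have hb := hX.mem_of_implies hub hu
          refine ih.trans (Implies.of_mem (mk_mem_restrict.mpr
            ⟨hbc, (mem_clauses_of_arc hF hbc).1, mem_vars.mpr ⟨b, hb, rfl⟩,
              mem_vars.mpr ⟨c, hX _ _ hbc hb, rfl⟩⟩))
    rw [residualWeight, residualWeight, if_pos h, if_pos hcl, hrestr, hA,
      signedWeight_union hdis2 Finset.inter_subset_right Finset.inter_subset_right, hord]
    ring
  · rw [residualWeight, if_neg h, zero_add, residualWeight]
    split_ifs with hcl
    · rw [signedWeight, if_neg]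
      exact fun hiso => h (succClosed_union_negSet hF hX hT hcl hiso)
    · rfl

end Sink

/-- The signed number of closed partial assignments is `1`. -/
theorem sum_residualWeight (A : Finset (Fin n)) (F : Finset (Sym2 (Literal n)))
    (hF : F ⊆ clauses A) : ∑ T ∈ partials A, residualWeight A F T = 1 := by
  classical
  induction A using Finset.strongInduction generalizing F with
  | H A ih =>
    by_cases hall : ∀ i ∈ A, IsContradictoryVariable F i
    · rw [Finset.sum_eq_single_of_mem ∅ (mem_partials.mpr ⟨by simp [Consistent], by simp [vars]⟩)]
      · have h1 : vars (∅ : Finset (Literal n)) = ∅ := rfl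
        have h2 : SuccClosed F ∅ := fun _ _ _ h => absurd h (Finset.notMem_empty _)
        rw [residualWeight, if_pos h2, h1, Finset.sdiff_empty, restrict,
          Finset.inter_eq_left.mpr hF, signedWeight_of_contradictory hF hall]
      · intro T hT hne
        obtain ⟨hTc, hTA⟩ := mem_partials.mp hT
        obtain ⟨x, hx⟩ := Finset.nonempty_iff_ne_empty.mpr hne
        -- A closed set containing a literal of a contradictory variable also contains its negation.
        refine if_neg fun hcl => hTc x hx (hcl.mem_of_implies ?_ hx)
        exact ((isContradictoryVariable_iff x).mp
          (hall _ (hTA (mem_vars.mpr ⟨x, hx, rfl⟩)))).1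
    · push Not at hall
      obtain ⟨i, hi, hc⟩ := hall
      obtain ⟨X, hXp, hne, hX, hconn⟩ := exists_sink hF hi hc
      obtain ⟨hXc, hXA⟩ := mem_partials.mp hXp
      have hlt : A \ vars X ⊂ A := by
        obtain ⟨x, hx⟩ := hne
        refine Finset.sdiff_ssubset hXA ⟨x.1, mem_vars.mpr ⟨x, hx, rfl⟩⟩
      rw [sum_partials_split hXp hne, ← Finset.sum_add_distrib,
        Finset.sum_eq_zero (fun T hT => residualWeight_add_union_negSet hF hX hXp hne hconn hT),
        add_zero, Finset.sum_congr rfl fun T hT => residualWeight_union_sink hF hX hT]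
      · exact ih _ hlt _ Finset.inter_subset_right
      · intro T hT
        have hcl : SuccClosed F T := by
          by_contra h
          exact hT (if_neg h)
        by_contra hcon
        push Not at hcon
        obtain ⟨h1, h2, h3⟩ := hcon
        -- Once `T` meets the variables of `X`, strong connectivity forces all of `X` into `T`, or,
        -- through contrapositive paths, all of `negSet X`.
        obtain ⟨j, hjT, hjX⟩ := Finset.not_disjoint_iff.mp h1
        obtain ⟨x, hx, rfl⟩ := mem_vars.mp hjX
        rcases fst_mem_vars.mp hjT with h | h
        · exact h2 fun v hv => hcl.mem_of_implies (hconn x hx v hv) h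
        · refine h3 fun v hv => ?_
          have := (hconn _ (mem_negSet.mp hv) x hx).contrapositive
          rw [Literal.neg_neg] at this
          exact hcl.mem_of_implies this h

/-! ### Counting sets of clauses -/

theorem sum_powerset_X_pow_card {α : Type*} [DecidableEq α] (s : Finset α) :
    ∑ t ∈ s.powerset, (Polynomial.X : ℚ[X]) ^ t.card = (1 + Polynomial.X) ^ s.card := by
  have h := Finset.prod_one_add (f := fun _ : α => (Polynomial.X : ℚ[X])) s
  simp only [Finset.prod_const] at h
  exact h.symm

theorem sum_powerset_union {α M : Type*} [DecidableEq α] [AddCommMonoid M] {s t : Finset α}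
    (hst : Disjoint s t) (f : Finset α → M) :
    ∑ u ∈ (s ∪ t).powerset, f u = ∑ a ∈ s.powerset, ∑ b ∈ t.powerset, f (a ∪ b) := by
  rw [← Finset.sum_product']
  have hd := Finset.disjoint_left.mp hst
  refine Finset.sum_nbij' (fun u => (u ∩ s, u ∩ t)) (fun p => p.1 ∪ p.2) ?_ ?_ ?_ ?_ ?_
  · intro u _
    simp
  · rintro ⟨a, b⟩ h
    obtain ⟨ha, hb⟩ := Finset.mem_product.mp h
    exact Finset.mem_powerset.mpr
      (Finset.union_subset_union (Finset.mem_powerset.mp ha) (Finset.mem_powerset.mp hb))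
  · intro u hu
    rw [← Finset.inter_union_distrib_left, Finset.inter_eq_left.mpr (Finset.mem_powerset.mp hu)]
  · rintro ⟨a, b⟩ h
    obtain ⟨ha, hb⟩ := Finset.mem_product.mp h
    have ha' := Finset.mem_powerset.mp ha
    have hb' := Finset.mem_powerset.mp hb
    ext x
    · have h1 : x ∈ a → x ∈ s := fun h => ha' h
      have h2 : x ∈ b → x ∈ t := fun h => hb' h
      have h3 : x ∈ s → x ∉ t := fun h => hd h
      simp only [Finset.mem_inter, Finset.mem_union]
      tauto
    · have h1 : x ∈ a → x ∈ s := fun h => ha' h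
      have h2 : x ∈ b → x ∈ t := fun h => hb' h
      have h3 : x ∈ s → x ∉ t := fun h => hd h
      simp only [Finset.mem_inter, Finset.mem_union]
      tauto
  · intro u hu
    rw [← Finset.inter_union_distrib_left, Finset.inter_eq_left.mpr (Finset.mem_powerset.mp hu)]

/-- The signed count of the sets of clauses with variables from `A`. -/
def signedSum (A : Finset (Fin n)) : ℚ[X] :=
  ∑ F ∈ (clauses A).powerset, Polynomial.X ^ F.card * signedWeight A F

open Classical in
/-- The clauses with variables from `A` that contain a literal of `T`. -/
def satisfied (A : Finset (Fin n)) (T : Finset (Literal n)) : Finset (Sym2 (Literal n)) :=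
  (clauses A).filter fun c => ∃ x ∈ c, x ∈ T

theorem mk_mem_satisfied {A : Finset (Fin n)} {T : Finset (Literal n)} {k l : Literal n} :
    s(k, l) ∈ satisfied A T ↔ (k.1 ≠ l.1 ∧ k.1 ∈ A ∧ l.1 ∈ A) ∧ (k ∈ T ∨ l ∈ T) := by
  simp only [satisfied, Finset.mem_filter, mk_mem_clauses, Sym2.mem_iff, exists_eq_or_imp,
    exists_eq_left]

/-- Each clause is two arcs, so closedness says that a clause with one literal falsified by `T` has
the other in `T`. The clauses of a closed instance thus fall into an unassigned part and a satisfied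
part, chosen independently. -/
theorem succClosed_iff_subset {A : Finset (Fin n)} {F : Finset (Sym2 (Literal n))}
    {T : Finset (Literal n)} (hF : F ⊆ clauses A) (hT : Consistent T) :
    SuccClosed F T ↔ F ⊆ clauses (A \ vars T) ∪ satisfied A T := by
  constructor
  · intro h c hc
    induction c with
    | _ k l =>
      have hkl := mk_mem_clauses.mp (hF hc)
      rw [Finset.mem_union, mk_mem_clauses, mk_mem_satisfied, Finset.mem_sdiff, Finset.mem_sdiff,
        fst_mem_vars, fst_mem_vars]
      have h1 := h k.neg l (by simpa using hc)
      have h2 := h l.neg k (by simpa [Sym2.eq_swap] using hc)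
      tauto
  · intro h x y hxy hx
    have h1 := h hxy
    rw [Finset.mem_union, mk_mem_clauses, mk_mem_satisfied, Finset.mem_sdiff] at h1
    rcases h1 with h1 | ⟨_, h1 | h1⟩
    · exact absurd (mem_vars.mpr ⟨x, hx, rfl⟩) h1.2.1.2
    · exact absurd h1 (hT x hx)
    · exact h1

theorem disjoint_clauses_satisfied (A : Finset (Fin n)) (T : Finset (Literal n)) :
    Disjoint (clauses (A \ vars T)) (satisfied A T) := by
  rw [Finset.disjoint_left]
  intro c
  induction c with
  | _ k l =>
    rw [mk_mem_clauses, mk_mem_satisfied, Finset.mem_sdiff, Finset.mem_sdiff, fst_mem_vars,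
      fst_mem_vars]
    tauto

theorem sum_residualWeight_eq {A : Finset (Fin n)} {T : Finset (Literal n)}
    (hT : T ∈ partials A) :
    ∑ F ∈ (clauses A).powerset, Polynomial.X ^ F.card * residualWeight A F T =
      signedSum (A \ vars T) * (1 + Polynomial.X) ^ (satisfied A T).card := by
  classical
  have hT' := (mem_partials.mp hT).1
  have hsub : clauses (A \ vars T) ∪ satisfied A T ⊆ clauses A :=
    Finset.union_subset (clauses_mono Finset.sdiff_subset) (Finset.filter_subset _ _)
  have hd := disjoint_clauses_satisfied A T
  rw [← Finset.sum_subset (Finset.powerset_mono.mpr hsub), sum_powerset_union hd, signedSum,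
    Finset.sum_mul]
  · refine Finset.sum_congr rfl fun F₁ hF₁ => ?_
    rw [← sum_powerset_X_pow_card, Finset.mul_sum]
    refine Finset.sum_congr rfl fun F₂ hF₂ => ?_
    have h1 := Finset.mem_powerset.mp hF₁
    have h2 := Finset.mem_powerset.mp hF₂
    have hu := Finset.union_subset_union h1 h2
    have h3 : restrict (F₁ ∪ F₂) (A \ vars T) = F₁ := by
      rw [restrict, Finset.union_inter_distrib_right, Finset.inter_eq_left.mpr h1,
        Finset.disjoint_iff_inter_eq_empty.mp (hd.symm.mono_left h2), Finset.union_empty]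
    rw [residualWeight, if_pos ((succClosed_iff_subset (hu.trans hsub) hT').mpr hu), h3,
      Finset.card_union_of_disjoint (hd.mono h1 h2), pow_add]
    ring
  · intro F hF hF'
    rw [residualWeight, if_neg, mul_zero]
    intro h
    exact hF' (Finset.mem_powerset.mpr
      ((succClosed_iff_subset (Finset.mem_powerset.mp hF) hT').mp h))

/-- Double counting of pairs `(F, T)`: for each `F` the sum over `T` is `1`, while for each `T` the
sum over `F` factors. -/
theorem one_add_X_pow_card_clauses (A : Finset (Fin n)) :
    (1 + Polynomial.X : ℚ[X]) ^ (clauses A).card = ∑ T ∈ partials A,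
      signedSum (A \ vars T) * (1 + Polynomial.X) ^ (satisfied A T).card := by
  rw [← sum_powerset_X_pow_card, ← Finset.sum_congr rfl fun T hT => sum_residualWeight_eq hT,
    Finset.sum_comm]
  refine Finset.sum_congr rfl fun F hF => ?_
  rw [← Finset.mul_sum, sum_residualWeight A F (Finset.mem_powerset.mp hF), mul_one]

/-! ### Numbers of clauses and of assignments -/

theorem Consistent.fst_injOn {T : Finset (Literal n)} (hT : Consistent T) :
    Set.InjOn Prod.fst (T : Set (Literal n)) := by
  intro x hx y hy hxy
  rcases Literal.eq_or_eq_neg hxy with h | rfl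
  · exact h
  · exact absurd hx (hT y hy)

theorem Consistent.card_vars {T : Finset (Literal n)} (hT : Consistent T) :
    (vars T).card = T.card :=
  Finset.card_image_of_injOn hT.fst_injOn

theorem Consistent.card_clauses_subset {A : Finset (Fin n)} {T : Finset (Literal n)}
    (hT : T ∈ partials A) :
    ((clauses A).filter fun c => ∀ x ∈ c, x ∈ T).card = T.card.choose 2 := by
  obtain ⟨hTc, hTA⟩ := mem_partials.mp hT
  rw [← Sym2.card_image_offDiag]
  congr 1
  ext c
  induction c with
  | _ k l =>
    simp only [Finset.mem_filter, mk_mem_clauses, Sym2.mem_iff, forall_eq_or_imp, forall_eq,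
      Finset.mem_image, Finset.mem_offDiag]
    constructor
    · rintro ⟨⟨h, -⟩, hk, hl⟩
      exact ⟨(k, l), ⟨hk, hl, fun h' => h (congrArg Prod.fst h')⟩, rfl⟩
    · rintro ⟨⟨a, b⟩, ⟨ha, hb, hab⟩, h⟩
      have key : ∀ {a b : Literal n}, a ∈ T → b ∈ T → a ≠ b →
          (a.1 ≠ b.1 ∧ a.1 ∈ A ∧ b.1 ∈ A) ∧ a ∈ T ∧ b ∈ T := fun ha hb hab =>
        ⟨⟨fun h' => hab (hTc.fst_injOn ha hb h'), hTA (mem_vars.mpr ⟨_, ha, rfl⟩),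
          hTA (mem_vars.mpr ⟨_, hb, rfl⟩)⟩, ha, hb⟩
      rcases Sym2.eq_iff.mp h with ⟨rfl, rfl⟩ | ⟨rfl, rfl⟩
      · exact key ha hb hab
      · exact key hb ha hab.symm

theorem card_satisfied {A : Finset (Fin n)} {T : Finset (Literal n)} (hT : T ∈ partials A) :
    (satisfied A T).card = T.card.choose 2 + T.card * (2 * A.card - T.card - 1) := by
  classical
  obtain ⟨hTc, hTA⟩ := mem_partials.mp hT
  have hTA' : ∀ x ∈ T, x.1 ∈ A := fun x hx => hTA (mem_vars.mpr ⟨x, hx, rfl⟩)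
  rw [← Finset.card_filter_add_card_filter_not (s := satisfied A T) fun c => ∀ x ∈ c, x ∈ T,
    ← Consistent.card_clauses_subset hT]
  congr 1
  · congr 1
    ext c
    induction c with
    | _ k l =>
      simp only [Finset.mem_filter, mk_mem_clauses, mk_mem_satisfied, Sym2.mem_iff,
        forall_eq_or_imp, forall_eq]
      tauto
  -- A clause with exactly one literal `x` in `T` has its other literal among the `2 * A.card`
  -- literals on `A`, outside `T` and different from `x.neg`.
  · let Q : Literal n → Finset (Literal n) := fun x => ((A ×ˢ Finset.univ) \ T).erase x.neg
    have hQ : ∀ x ∈ T, (Q x).card = 2 * A.card - T.card - 1 := by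
      intro x hx
      have hsub : T ⊆ A ×ˢ (Finset.univ : Finset Bool) := fun y hy => by simp [hTA' y hy]
      rw [Finset.card_erase_of_mem (by simp [hTA' x hx, hTc x hx]),
        Finset.card_sdiff_of_subset hsub, Finset.card_product]
      simp [mul_comm]
    rw [← smul_eq_mul, ← Finset.sum_const, ← Finset.sum_congr rfl hQ, ← Finset.card_sigma]
    symm
    refine Finset.card_nbij (fun p => s(p.1, p.2)) ?_ ?_ ?_
    · rintro ⟨x, y⟩ h
      obtain ⟨hx, hy⟩ := Finset.mem_sigma.mp h
      simp only [Q, Finset.mem_erase, Finset.mem_sdiff, Finset.mem_product, Finset.mem_univ,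
        and_true] at hx hy
      change s(x, y) ∈ Finset.filter _ _
      simp only [Finset.mem_filter, mk_mem_satisfied, Sym2.mem_iff, forall_eq_or_imp, forall_eq]
      refine ⟨⟨⟨fun h' => ?_, hTA' x hx, hy.2.1⟩, Or.inl hx⟩, fun h' => hy.2.2 h'.2⟩
      rcases Literal.eq_or_eq_neg h' with rfl | rfl
      · exact hy.2.2 hx
      · exact hy.1 (by simp)
    · rintro ⟨x, y⟩ h ⟨x', y'⟩ h' heq
      obtain ⟨hx, hy⟩ := Finset.mem_sigma.mp h
      obtain ⟨hx', hy'⟩ := Finset.mem_sigma.mp h'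
      simp only [Q, Finset.mem_erase, Finset.mem_sdiff] at hx hy hx' hy'
      rcases Sym2.eq_iff.mp heq with ⟨rfl, rfl⟩ | ⟨rfl, rfl⟩
      · rfl
      · exact absurd hx hy'.2.2
    · intro c
      induction c with
      | _ k l =>
        intro hc
        simp only [Finset.coe_filter, Set.mem_ofPred_eq, mk_mem_satisfied, Sym2.mem_iff,
          forall_eq_or_imp, forall_eq] at hc
        obtain ⟨⟨⟨hkl, hk, hl⟩, h1⟩, h2⟩ := hc
        have key : ∀ {a b : Literal n}, a.1 ≠ b.1 → b.1 ∈ A → a ∈ T → b ∉ T →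
            (⟨a, b⟩ : Σ _ : Literal n, Literal n) ∈ T.sigma Q := by
          intro a b hab hb ha hbT
          simp only [Q, Finset.mem_sigma, Finset.mem_erase, Finset.mem_sdiff, Finset.mem_product,
            Finset.mem_univ, and_true]
          exact ⟨ha, fun h => hab (by rw [h]; rfl), hb, hbT⟩
        rcases h1 with h1 | h1
        · exact ⟨⟨k, l⟩, key hkl hl h1 fun h => h2 ⟨h1, h⟩, rfl⟩
        · exact ⟨⟨l, k⟩, key hkl.symm hk h1 fun h => h2 ⟨h, h1⟩, Sym2.eq_swap⟩

/-- The assignment of the variables in `B` for which exactly those in `P` are true. -/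
def assignment (B P : Finset (Fin n)) : Finset (Literal n) :=
  B.image fun i => (i, decide (i ∈ P))

theorem mem_assignment {B P : Finset (Fin n)} {x : Literal n} :
    x ∈ assignment B P ↔ x.1 ∈ B ∧ x.2 = decide (x.1 ∈ P) := by
  rw [assignment, Finset.mem_image]
  constructor
  · rintro ⟨i, hi, rfl⟩
    exact ⟨hi, rfl⟩
  · rintro ⟨h1, h2⟩
    exact ⟨x.1, h1, Prod.ext rfl h2.symm⟩

theorem consistent_assignment (B P : Finset (Fin n)) : Consistent (assignment B P) := by
  intro x hx hx'
  have h1 := (mem_assignment.mp hx).2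
  have h2 := (mem_assignment.mp hx').2
  rw [Literal.neg_fst, ← h1] at h2
  simp [Literal.neg] at h2

theorem vars_assignment (B P : Finset (Fin n)) : vars (assignment B P) = B := by
  ext i
  rw [mem_vars]
  constructor
  · rintro ⟨x, hx, rfl⟩
    exact (mem_assignment.mp hx).1
  · intro hi
    exact ⟨(i, decide (i ∈ P)), mem_assignment.mpr ⟨hi, rfl⟩, rfl⟩

/-- The assignments of the variables in `B`. -/
def assignments (B : Finset (Fin n)) : Finset (Finset (Literal n)) :=
  (partials B).filter fun T => vars T = B

theorem mem_assignments {B : Finset (Fin n)} {T : Finset (Literal n)} :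
    T ∈ assignments B ↔ Consistent T ∧ vars T = B := by
  rw [assignments, Finset.mem_filter, mem_partials]
  exact ⟨fun h => ⟨h.1.1, h.2⟩, fun h => ⟨⟨h.1, h.2.le⟩, h.2⟩⟩

theorem card_assignments (B : Finset (Fin n)) : (assignments B).card = 2 ^ B.card := by
  classical
  rw [← Finset.card_powerset]
  symm
  refine Finset.card_nbij' (assignment B) (fun T => B.filter fun i => (i, true) ∈ T) ?_ ?_ ?_ ?_
  · intro P _
    exact mem_assignments.mpr ⟨consistent_assignment B P, vars_assignment B P⟩
  · intro T _
    exact Finset.mem_powerset.mpr (Finset.filter_subset _ _)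
  · intro P hP
    ext i
    have : i ∈ P → i ∈ B := fun h => Finset.mem_powerset.mp hP h
    simp only [Finset.mem_filter, mem_assignment]
    simp only [eq_comm (a := true), decide_eq_true_iff]
    tauto
  · intro T hT
    obtain ⟨hTc, rfl⟩ := mem_assignments.mp hT
    ext ⟨i, b⟩
    rw [mem_assignment]
    simp only [Finset.mem_filter]
    have h1 := hTc (i, true)
    have h2 := hTc (i, false)
    have h3 := fst_mem_vars (T := T) (x := (i, true))
    simp only [Literal.neg, Bool.not_true, Bool.not_false] at h1 h2 h3
    cases b <;> simp <;> tauto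

theorem sum_partials_eq_sum_powerset {M : Type*} [AddCommMonoid M] (A : Finset (Fin n))
    (f : Finset (Fin n) → M) :
    ∑ T ∈ partials A, f (vars T) = ∑ B ∈ A.powerset, 2 ^ B.card • f B := by
  classical
  rw [← Finset.sum_fiberwise_of_maps_to (s := partials A) (t := A.powerset) (g := vars)
    fun T hT => Finset.mem_powerset.mpr (mem_partials.mp hT).2]
  refine Finset.sum_congr rfl fun B hB => ?_
  have h : (partials A).filter (fun T => vars T = B) = assignments B := by
    ext T
    rw [Finset.mem_filter, mem_partials, mem_assignments]
    have := Finset.mem_powerset.mp hB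
    exact ⟨fun h => ⟨h.1.1, h.2⟩, fun h => ⟨⟨h.1, h.2.le.trans this⟩, h.2⟩⟩
  rw [h, ← card_assignments, ← Finset.sum_const]
  exact Finset.sum_congr rfl fun T hT => by rw [(mem_assignments.mp hT).2]

theorem card_clauses (A : Finset (Fin n)) :
    (clauses A).card = 2 * (A.card * (A.card - 1)) := by
  classical
  -- Any full assignment serves: a clause is either satisfied by `T` or lies entirely in `negSet T`,
  -- and both kinds are already counted.
  let T := assignment A A
  have hc : Consistent T := consistent_assignment A A
  have hv : vars T = A := vars_assignment A A
  have hT : T ∈ partials A := mem_partials.mpr ⟨hc, hv.le⟩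
  have hT' : negSet T ∈ partials A := mem_partials.mpr ⟨hc.negSet, by rw [vars_negSet, hv]⟩
  have hcard : T.card = A.card := by rw [← hc.card_vars, hv]
  have hcard' : (negSet T).card = A.card := by rw [← hc.negSet.card_vars, vars_negSet, hv]
  rw [← Finset.card_filter_add_card_filter_not (s := clauses A) fun c => ∃ x ∈ c, x ∈ T]
  have h1 : ((clauses A).filter fun c => ∃ x ∈ c, x ∈ T).card =
      T.card.choose 2 + T.card * (2 * A.card - T.card - 1) := by
    rw [← card_satisfied hT, satisfied]
  have h2 : ((clauses A).filter fun c => ¬ ∃ x ∈ c, x ∈ T) =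
      (clauses A).filter fun c => ∀ x ∈ c, x ∈ negSet T := by
    refine Finset.filter_congr fun c hc' => ?_
    simp only [not_exists, not_and]
    refine forall₂_congr fun x hx => ?_
    have hxA : x.1 ∈ A := (Finset.mem_filter.mp hc').2.2 x hx
    rw [← hv, fst_mem_vars] at hxA
    rw [mem_negSet]
    have := hc x
    tauto
  rw [h1, h2, Consistent.card_clauses_subset hT', hcard, hcard']
  have h3 : A.card.choose 2 * 2 = A.card * (A.card - 1) := by
    rw [Nat.choose_two_right, Nat.div_mul_cancel (Nat.even_mul_pred_self _).two_dvd]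
  have h4 : 2 * A.card - A.card - 1 = A.card - 1 := by omega
  rw [h4]
  omega

/-! ### Splitting off the component of a variable -/

theorem Isolated.fst_mem_variableClass {F : Finset (Sym2 (Literal n))} (hF : Isolated F)
    {i : Fin n} {u v : Literal n} (h : Implies F u v) (hu : u.1 ∈ variableClass F i) :
    v.1 ∈ variableClass F i := by
  obtain ⟨y, hy, hiy⟩ := mem_variableClass_iff.mp hu
  rw [mem_variableClass_iff]
  rcases Literal.eq_or_eq_neg hy with rfl | rfl
  · exact ⟨v, rfl, hiy.trans h⟩
  · exact ⟨v.neg, rfl, hiy.trans (hF _ _ h.contrapositive)⟩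

theorem Isolated.subset_clauses_union {A : Finset (Fin n)} {F : Finset (Sym2 (Literal n))}
    (hiso : Isolated F) (hF : F ⊆ clauses A) (i : Fin n) :
    F ⊆ clauses (variableClass F i) ∪ clauses (A \ variableClass F i) := by
  intro c hc
  induction c with
  | _ k l =>
    obtain ⟨h1, h2, h3⟩ := mk_mem_clauses.mp (hF hc)
    have h4 : Implies F k.neg l := Implies.of_mem (by simpa using hc)
    have h5 : k.1 ∈ variableClass F i → l.1 ∈ variableClass F i :=
      hiso.fst_mem_variableClass (u := k.neg) h4
    have h6 : l.1 ∈ variableClass F i → k.1 ∈ variableClass F i :=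
      hiso.fst_mem_variableClass (v := k.neg) (hiso _ _ h4)
    rw [Finset.mem_union, mk_mem_clauses, mk_mem_clauses, Finset.mem_sdiff, Finset.mem_sdiff]
    tauto

open Classical in
/-- The signed count of the sets of clauses for which `B` is the class of the variable `a`. -/
def componentSum (a : Fin n) (B : Finset (Fin n)) : ℚ[X] :=
  ∑ F ∈ (clauses B).powerset with variableClass F a = B, Polynomial.X ^ F.card * signedWeight B F

/-- In an isolated instance no clause crosses between the class of `a` and the rest, so the sum over
`F` factors; all other instances have weight zero. Marking `a` avoids counting unordered families of
components. -/
theorem signedSum_eq_sum_componentSum {A : Finset (Fin n)} {a : Fin n} (ha : a ∈ A) :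
    signedSum A = ∑ B ∈ A.powerset with a ∈ B, componentSum a B * signedSum (A \ B) := by
  classical
  rw [signedSum, ← Finset.sum_fiberwise_of_maps_to (t := A.powerset.filter (a ∈ ·))
    (g := fun F => variableClass F a) fun F hF => Finset.mem_filter.mpr
      ⟨Finset.mem_powerset.mpr (variableClass_subset (Finset.mem_powerset.mp hF) ha),
        self_mem_variableClass F a⟩]
  refine Finset.sum_congr rfl fun B hB => ?_
  obtain ⟨hBA, haB⟩ := Finset.mem_filter.mp hB
  rw [Finset.mem_powerset] at hBA
  have hd : Disjoint B (A \ B) := Finset.disjoint_sdiff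
  have hdc := disjoint_clauses hd
  have hsub : clauses B ∪ clauses (A \ B) ⊆ clauses A :=
    Finset.union_subset (clauses_mono hBA) (clauses_mono Finset.sdiff_subset)
  rw [Finset.sum_filter, ← Finset.sum_subset (Finset.powerset_mono.mpr hsub),
    sum_powerset_union hdc, componentSum, Finset.sum_mul, Finset.sum_filter]
  · refine Finset.sum_congr rfl fun F₁ hF₁ => ?_
    have h1 := Finset.mem_powerset.mp hF₁
    have hv : ∀ F₂ ⊆ clauses (A \ B), variableClass (F₁ ∪ F₂) a = variableClass F₁ a :=
      fun F₂ h2 => variableClass_union_left hd h1 h2 (Finset.disjoint_left.mp hd haB)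
    split_ifs with h
    · rw [signedSum, Finset.mul_sum]
      refine Finset.sum_congr rfl fun F₂ hF₂ => ?_
      have h2 := Finset.mem_powerset.mp hF₂
      have hu := signedWeight_union hd h1 h2
      rw [Finset.union_sdiff_of_subset hBA] at hu
      rw [if_pos ((hv F₂ h2).trans h), hu, Finset.card_union_of_disjoint (hdc.mono h1 h2), pow_add]
      ring
    · refine Finset.sum_eq_zero fun F₂ hF₂ => if_neg ?_
      rwa [hv F₂ (Finset.mem_powerset.mp hF₂)]
  · intro F hF hF'
    split_ifs with h
    · rw [signedWeight, if_neg, mul_zero]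
      intro hiso
      have := hiso.subset_clauses_union (Finset.mem_powerset.mp hF) a
      rw [h] at this
      exact hF' (Finset.mem_powerset.mpr this)
    · rfl

open Classical in
/-- The sets of clauses with variables from `B` for which all literals of these variables lie in
one strongly connected component. -/
def contradictorySets (B : Finset (Fin n)) : Finset (Finset (Sym2 (Literal n))) :=
  (clauses B).powerset.filter fun F => ∀ u v : Literal n, u.1 ∈ B → v.1 ∈ B → Implies F u v

/-- The clauses that give arcs between literals of `X`. -/
def arcClauses (X : Finset (Literal n)) : Finset (Sym2 (Literal n)) :=
  X.offDiag.image fun p => s(p.1.neg, p.2)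

open Classical in
/-- The sets of clauses for which `X` is a strongly connected component, isolated from the
component formed by the negations. -/
def ordinarySets (X : Finset (Literal n)) : Finset (Finset (Sym2 (Literal n))) :=
  (arcClauses X).powerset.filter fun F => ∀ u ∈ X, ∀ v ∈ X, Implies F u v

theorem mk_neg_mem_arcClauses {X : Finset (Literal n)} {u v : Literal n} :
    s(u.neg, v) ∈ arcClauses X ↔ u ≠ v ∧ (u ∈ X ∧ v ∈ X ∨ u.neg ∈ X ∧ v.neg ∈ X) := by
  simp only [arcClauses, Finset.mem_image, Finset.mem_offDiag]
  constructor
  · rintro ⟨⟨x, y⟩, ⟨hx, hy, hxy⟩, h⟩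
    rcases Sym2.eq_iff.mp h with ⟨h1, h2⟩ | ⟨h1, h2⟩
    · rw [Literal.neg_eq_iff, Literal.neg_neg] at h1
      subst h1 h2
      exact ⟨hxy, Or.inl ⟨hx, hy⟩⟩
    · simp only at h1 h2
      subst h1 h2
      exact ⟨fun h => hxy (by rw [h, Literal.neg_neg]), Or.inr ⟨hy, by simpa using hx⟩⟩
  · rintro ⟨h, ⟨hu, hv⟩ | ⟨hu, hv⟩⟩
    · exact ⟨(u, v), ⟨hu, hv, h⟩, rfl⟩
    · refine ⟨(v.neg, u.neg), ⟨hv, hu, fun h' => h ?_⟩, ?_⟩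
      · rw [← Literal.neg_neg u, ← show v.neg = u.neg from h', Literal.neg_neg]
      · simp [Sym2.eq_swap]

theorem arcClauses_subset {X : Finset (Literal n)} (hX : Consistent X) :
    arcClauses X ⊆ clauses (vars X) := by
  intro c hc
  obtain ⟨⟨x, y⟩, h, rfl⟩ := Finset.mem_image.mp hc
  obtain ⟨hx, hy, hxy⟩ := Finset.mem_offDiag.mp h
  exact mk_mem_clauses.mpr ⟨fun h => hxy (hX.fst_injOn hx hy h), mem_vars.mpr ⟨x, hx, rfl⟩,
    mem_vars.mpr ⟨y, hy, rfl⟩⟩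

theorem succClosed_of_subset_arcClauses {X : Finset (Literal n)} (hX : Consistent X)
    {F : Finset (Sym2 (Literal n))} (hF : F ⊆ arcClauses X) : SuccClosed F X := by
  intro x y hxy hx
  rcases (mk_neg_mem_arcClauses.mp (hF hxy)).2 with h | h
  · exact h.2
  · exact absurd h.1 (hX x hx)

theorem succClosed_negSet_of_subset_arcClauses {X : Finset (Literal n)} (hX : Consistent X)
    {F : Finset (Sym2 (Literal n))} (hF : F ⊆ arcClauses X) : SuccClosed F (negSet X) := by
  intro x y hxy hx
  rw [mem_negSet] at hx ⊢
  rcases (mk_neg_mem_arcClauses.mp (hF hxy)).2 with h | h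
  · exact absurd hx (hX x h.1)
  · exact h.2

open Classical in
/-- The literals that are implied by `z`. -/
def successors (F : Finset (Sym2 (Literal n))) (z : Literal n) : Finset (Literal n) :=
  Finset.univ.filter (Implies F z)

theorem mem_successors {F : Finset (Sym2 (Literal n))} {z v : Literal n} :
    v ∈ successors F z ↔ Implies F z v := by
  simp [successors]

theorem variableClass_eq_vars_successors (F : Finset (Sym2 (Literal n))) (a : Fin n) :
    variableClass F a = vars (successors F (a, true)) := by
  ext j
  simp only [mem_variableClass_iff, mem_vars, mem_successors]
  exact exists_congr fun y => and_comm

theorem successors_eq_of_mem_ordinarySets {X : Finset (Literal n)} (hX : Consistent X)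
    {F : Finset (Sym2 (Literal n))} (hF : F ∈ ordinarySets X) {z : Literal n} (hz : z ∈ X) :
    successors F z = X := by
  classical
  obtain ⟨hF1, hF2⟩ := Finset.mem_filter.mp hF
  ext v
  rw [mem_successors]
  exact ⟨fun h => (succClosed_of_subset_arcClauses hX
    (Finset.mem_powerset.mp hF1)).mem_of_implies h hz, hF2 z hz v⟩

theorem signedWeight_of_mem_ordinarySets {X : Finset (Literal n)} (hX : Consistent X)
    (hne : X.Nonempty) {F : Finset (Sym2 (Literal n))} (hF : F ∈ ordinarySets X) :
    signedWeight (vars X) F = -1 := by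
  classical
  obtain ⟨hF1, hF2⟩ := Finset.mem_filter.mp hF
  rw [Finset.mem_powerset] at hF1
  exact signedWeight_of_ordinary hne hX (hF1.trans (arcClauses_subset hX))
    (succClosed_of_subset_arcClauses hX hF1) (succClosed_negSet_of_subset_arcClauses hX hF1) hF2

theorem Isolated.successors_mem_assignments {F : Finset (Sym2 (Literal n))} (hF : Isolated F)
    {a : Fin n} (ha : ¬ IsContradictoryVariable F a) :
    successors F (a, true) ∈ assignments (variableClass F a) := by
  refine mem_assignments.mpr ⟨fun x hx hx' => ha ?_, (variableClass_eq_vars_successors F a).symm⟩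
  rw [mem_successors] at hx hx'
  have h : Implies F (a, true) (a, false) := by
    have := hx'.contrapositive
    rw [Literal.neg_neg] at this
    exact hx.trans this
  exact ⟨h, hF _ _ h⟩

theorem Isolated.mem_ordinarySets {F : Finset (Sym2 (Literal n))} (hF : Isolated F)
    {a : Fin n} (hFc : F ⊆ clauses (variableClass F a)) : F ∈ ordinarySets (successors F (a, true)) := by
  classical
  refine Finset.mem_filter.mpr ⟨Finset.mem_powerset.mpr fun c hc => ?_, fun u hu v hv => ?_⟩
  · induction c with
    | _ k l =>
      obtain ⟨h1, h2, h3⟩ := mk_mem_clauses.mp (hFc hc)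
      have h4 : Implies F k.neg l := Implies.of_mem (by simpa using hc)
      rw [variableClass_eq_vars_successors, fst_mem_vars, mem_successors, mem_successors] at h2
      rw [← Literal.neg_neg k, mk_neg_mem_arcClauses, Literal.neg_neg]
      refine ⟨fun h => h1 (by rw [← h]; rfl), ?_⟩
      simp only [mem_successors]
      rcases h2 with h2 | h2
      · have h5 : Implies F k l.neg := by simpa using (hF _ _ h4).contrapositive
        exact Or.inr ⟨h2, h2.trans h5⟩
      · exact Or.inl ⟨h2, h2.trans h4⟩
  · rw [mem_successors] at hu hv
    exact (hF _ _ hu).trans hv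

theorem Isolated.mem_contradictorySets {F : Finset (Sym2 (Literal n))} (hF : Isolated F)
    {a : Fin n} (ha : IsContradictoryVariable F a)
    (hFc : F ⊆ clauses (variableClass F a)) : F ∈ contradictorySets (variableClass F a) := by
  classical
  have key : ∀ u : Literal n, u.1 ∈ variableClass F a → Implies F (a, true) u := by
    intro u hu
    obtain ⟨y, hy, hay⟩ := mem_variableClass_iff.mp hu
    rcases Literal.eq_or_eq_neg hy with rfl | rfl
    · exact hay
    · exact Implies.trans ha.1 (by simpa [Literal.neg] using (hF _ _ hay).contrapositive)
  exact Finset.mem_filter.mpr ⟨Finset.mem_powerset.mpr hFc,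
    fun u v hu hv => (hF _ _ (key u hu)).trans (key v hv)⟩

theorem isolated_of_signedWeight_ne_zero {A : Finset (Fin n)} {F : Finset (Sym2 (Literal n))}
    (h : signedWeight A F ≠ 0) : Isolated F := by
  by_contra h'
  exact h (if_neg h')

/-- An ordinary pair is recorded by its member that contains the literal `(a, true)`, namely the
successors of that literal. This choice between `X` and `negSet X` is the source of the factor one
half. -/
theorem componentSum_eq {a : Fin n} {B : Finset (Fin n)} (ha : a ∈ B) :
    componentSum a B = ∑ F ∈ contradictorySets B, Polynomial.X ^ F.card -
      ∑ X ∈ assignments B with (a, true) ∈ X, ∑ F ∈ ordinarySets X, Polynomial.X ^ F.card := by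
  classical
  rw [componentSum, ← Finset.sum_filter_add_sum_filter_not _ fun F => IsContradictoryVariable F a,
    sub_eq_add_neg]
  congr 1
  · symm
    refine Finset.sum_congr_of_eq_on_inter ?_ ?_ ?_
    · intro F hF hF'
      obtain ⟨h1, h2⟩ := Finset.mem_filter.mp hF
      exfalso
      refine hF' (Finset.mem_filter.mpr ⟨Finset.mem_filter.mpr ⟨h1, ?_⟩,
        h2 _ _ ha ha, h2 _ _ ha ha⟩)
      exact (variableClass_subset (Finset.mem_powerset.mp h1) ha).antisymm fun j hj =>
        mem_variableClass_iff.mpr ⟨(j, true), rfl, h2 _ _ ha hj⟩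
    · intro F hF hF'
      obtain ⟨h1, h2⟩ := Finset.mem_filter.mp hF
      obtain ⟨h1, h3⟩ := Finset.mem_filter.mp h1
      by_contra h4
      have hiso := isolated_of_signedWeight_ne_zero (right_ne_zero_of_mul h4)
      have h5 := hiso.mem_contradictorySets h2
      rw [h3] at h5
      exact hF' (h5 (Finset.mem_powerset.mp h1))
    · intro F hF _
      obtain ⟨h1, h2⟩ := Finset.mem_filter.mp hF
      rw [signedWeight_of_contradictory (Finset.mem_powerset.mp h1)
        fun i hi => ⟨h2 _ _ hi hi, h2 _ _ hi hi⟩, mul_one]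
  · rw [← Finset.sum_neg_distrib]
    have hS : ∀ F ∈ ((clauses B).powerset.filter (fun F => variableClass F a = B)).filter
        (fun F => ¬ IsContradictoryVariable F a),
        Polynomial.X ^ F.card * signedWeight B F ≠ 0 → successors F (a, true) ∈
          (assignments B).filter ((a, true) ∈ ·) ∧ F ∈ ordinarySets (successors F (a, true)) := by
      intro F hF hne
      obtain ⟨h1, h2⟩ := Finset.mem_filter.mp hF
      obtain ⟨h1, h3⟩ := Finset.mem_filter.mp h1
      have hiso := isolated_of_signedWeight_ne_zero (right_ne_zero_of_mul hne)
      have h4 := hiso.successors_mem_assignments h2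
      have h5 := hiso.mem_ordinarySets (a := a)
      rw [h3] at h4 h5
      exact ⟨Finset.mem_filter.mpr ⟨h4, mem_successors.mpr (Implies.refl _ _)⟩,
        h5 (Finset.mem_powerset.mp h1)⟩
    rw [← Finset.sum_filter_ne_zero, ← Finset.sum_fiberwise_of_maps_to
      (t := (assignments B).filter ((a, true) ∈ ·)) (g := fun F => successors F (a, true))
      fun F hF => (hS F (Finset.mem_filter.mp hF).1 (Finset.mem_filter.mp hF).2).1]
    refine Finset.sum_congr rfl fun X hX => ?_
    obtain ⟨hXa, haX⟩ := Finset.mem_filter.mp hX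
    obtain ⟨hXc, hXB⟩ := mem_assignments.mp hXa
    have hw : ∀ F ∈ ordinarySets X, signedWeight B F = -1 := fun F hF => by
      rw [← hXB]
      exact signedWeight_of_mem_ordinarySets hXc ⟨_, haX⟩ hF
    rw [← Finset.sum_neg_distrib]
    refine Finset.sum_congr ?_ fun F hF => ?_
    · ext F
      constructor
      · intro hF
        obtain ⟨h1, h2⟩ := Finset.mem_filter.mp hF
        obtain ⟨h1, h3⟩ := Finset.mem_filter.mp h1
        rw [← h2]
        exact (hS F h1 h3).2
      · intro hF
        have hs := successors_eq_of_mem_ordinarySets hXc hF haX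
        have hF1 := Finset.mem_powerset.mp (Finset.mem_filter.mp hF).1
        have hv : variableClass F a = B := by
          rw [variableClass_eq_vars_successors, hs, hXB]
        refine Finset.mem_filter.mpr ⟨Finset.mem_filter.mpr ⟨Finset.mem_filter.mpr
          ⟨Finset.mem_filter.mpr ⟨Finset.mem_powerset.mpr ?_, hv⟩, fun hc => ?_⟩, ?_⟩, hs⟩
        · rw [← hXB]
          exact hF1.trans (arcClauses_subset hXc)
        · refine hXc _ haX ?_
          rw [← hs]
          exact mem_successors.mpr hc.1
        · rw [hw F hF]
          simp
    · rw [hw F hF, mul_neg_one]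

/-! ### The coefficients of the generating functions -/

open Classical in
/-- The arcs of a digraph on `Fin n`. -/
def arcFinset (D : Digraph (Fin n)) : Finset (Fin n × Fin n) :=
  Finset.univ.filter fun p => D.Adj p.1 p.2

theorem mem_arcFinset {D : Digraph (Fin n)} {p : Fin n × Fin n} :
    p ∈ arcFinset D ↔ D.Adj p.1 p.2 := by
  simp [arcFinset]

theorem card_arcFinset (D : Digraph (Fin n)) : (arcFinset D).card = arcCount D := by
  rw [arcCount, ← Set.ncard_coe_finset]
  congr 1
  ext p
  simp [mem_arcFinset]

open Classical in
theorem sum_digraphs (n : ℕ) :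
    ∑ D : Digraph (Fin n) with (∀ v, ¬ D.Adj v v) ∧ True, (Polynomial.X : ℚ[X]) ^ arcCount D =
      (1 + Polynomial.X) ^ (n * (n - 1)) := by
  have h : n * (n - 1) = (Finset.univ : Finset (Fin n)).offDiag.card := by
    rw [Finset.offDiag_card, Finset.card_fin, Nat.mul_sub_one]
  rw [h, ← sum_powerset_X_pow_card]
  refine Finset.sum_nbij' arcFinset (fun t => ⟨fun i j => (i, j) ∈ t⟩) ?_ ?_ ?_ ?_ ?_
  · intro D hD
    have h1 := (Finset.mem_filter.mp hD).2.1
    refine Finset.mem_powerset.mpr fun p hp => ?_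
    rw [mem_arcFinset] at hp
    refine Finset.mem_offDiag.mpr ⟨Finset.mem_univ _, Finset.mem_univ _, fun h => h1 p.1 ?_⟩
    rwa [← h] at hp
  · intro t ht
    refine Finset.mem_filter.mpr ⟨Finset.mem_univ _, fun v hv => ?_, trivial⟩
    exact (Finset.mem_offDiag.mp (Finset.mem_powerset.mp ht hv)).2.2 rfl
  · intro D _
    ext i j
    simp [mem_arcFinset]
  · intro t _
    ext p
    simp [mem_arcFinset]
  · intro D _
    rw [card_arcFinset]

open Classical in
theorem sum_graphs (n : ℕ) :
    ∑ G : SimpleGraph (Fin n), (Polynomial.X : ℚ[X]) ^ G.edgeSet.ncard =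
      (1 + Polynomial.X) ^ n.choose 2 := by
  have h : n.choose 2 = ((Finset.univ : Finset (Fin n)).offDiag.image (Function.uncurry Sym2.mk)).card := by
    rw [Sym2.card_image_offDiag, Finset.card_fin]
  have hmem : ∀ e : Sym2 (Fin n),
      e ∈ (Finset.univ : Finset (Fin n)).offDiag.image (Function.uncurry Sym2.mk) ↔ ¬ e.IsDiag := by
    intro e
    induction e with
    | _ i j =>
      rw [Finset.mem_image, Sym2.mk_isDiag_iff]
      constructor
      · rintro ⟨⟨k, l⟩, hkl, h⟩
        have hne := (Finset.mem_offDiag.mp hkl).2.2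
        rcases Sym2.eq_iff.mp h with ⟨rfl, rfl⟩ | ⟨rfl, rfl⟩
        · exact hne
        · exact Ne.symm hne
      · exact fun hij => ⟨(i, j), by simpa using hij, rfl⟩
  rw [h, ← sum_powerset_X_pow_card]
  refine Finset.sum_nbij' (fun G => G.edgeSet.toFinset)
    (fun t => SimpleGraph.fromEdgeSet (t : Set (Sym2 (Fin n)))) ?_ ?_ ?_ ?_ ?_
  · intro G _
    refine Finset.mem_powerset.mpr fun e he => (hmem e).mpr ?_
    exact G.not_isDiag_of_mem_edgeSet (Set.mem_toFinset.mp he)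
  · intro t _
    exact Finset.mem_univ _
  · intro G _
    simp
  · intro t ht
    ext e
    have h1 : e ∈ t → ¬ e.IsDiag := fun he => (hmem e).mp (Finset.mem_powerset.mp ht he)
    simpa [SimpleGraph.edgeSet_fromEdgeSet] using h1
  · intro G _
    rw [Set.ncard_eq_toFinset_card']

open Classical in
/-- The numerators of the coefficients of `SCC(z, w)`. -/
def sccSeq (k : ℕ) : ℚ[X] :=
  ∑ D : Digraph (Fin k) with (∀ v, ¬ D.Adj v v) ∧ IsStronglyConnected D,
    Polynomial.X ^ arcCount D

open Classical in
/-- The numerators of the coefficients of `CSCC(z, w)`. -/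
def csccSeq (k : ℕ) : ℚ[X] :=
  ∑ F : Finset (Sym2 (Literal k)) with IsTwoCNF F ∧ IsContradictorySCC F Set.univ,
    Polynomial.X ^ F.card

theorem sccGF_eq : sccGF = egf sccSeq := rfl

theorem csccGF_eq : csccGF = egf csccSeq := rfl

theorem digraphGF_eq : digraphGF = egf fun n => (1 + Polynomial.X) ^ (n * (n - 1)) := by
  unfold digraphGF digraphFamilyGF
  refine congrArg egf (funext fun n => ?_)
  rw [← sum_digraphs]
  congr

theorem graphGF_eq : graphGF = egf fun n => (1 + Polynomial.X) ^ n.choose 2 :=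
  congrArg egf (funext sum_graphs)

/-! ### Relabelling components as digraphs and 2-CNFs on `Fin k` -/

section Transfer

variable {k : ℕ}

/-- The clauses that give the arcs of a digraph on the literals of `X`. -/
def clausesOfDigraph (e : Fin k → Literal n) (D : Digraph (Fin k)) :
    Finset (Sym2 (Literal n)) :=
  (arcFinset D).image fun p => s((e p.1).neg, e p.2)

/-- The arcs that a set of clauses induces between the literals of `X`. -/
def digraphOfClauses (e : Fin k → Literal n) (F : Finset (Sym2 (Literal n))) :
    Digraph (Fin k) where
  Adj i j := s((e i).neg, e j) ∈ F

variable {X : Finset (Literal n)} {e : Fin k → Literal n}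

/-- The other reading of the clause is the contrapositive arc, whose ends are negations of elements
of `X` and so lie outside the consistent set `X`. -/
theorem mk_neg_injective (hX : Consistent X) (he : Function.Injective e) (heX : ∀ i, e i ∈ X) :
    Function.Injective fun p : Fin k × Fin k => s((e p.1).neg, e p.2) := by
  rintro ⟨i, j⟩ ⟨i', j'⟩ h
  rcases Sym2.eq_iff.mp h with ⟨h1, h2⟩ | ⟨h1, h2⟩
  · rw [Literal.neg_eq_iff, Literal.neg_neg] at h1
    exact Prod.ext (he h1) (he h2)
  · refine absurd (heX j') ?_
    rw [← show (e i).neg = e j' from h1]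
    exact hX _ (heX i)

theorem mk_mem_clausesOfDigraph (hX : Consistent X) (he : Function.Injective e)
    (heX : ∀ i, e i ∈ X) {D : Digraph (Fin k)} {i j : Fin k} :
    s((e i).neg, e j) ∈ clausesOfDigraph e D ↔ D.Adj i j := by
  have := (mk_neg_injective hX he heX).mem_finset_image (s := arcFinset D) (a := (i, j))
  rw [mem_arcFinset] at this
  exact this

theorem implies_iff_reachable (hX : Consistent X) (he : Function.Injective e)
    (heX : ∀ x, x ∈ X ↔ ∃ i, e i = x) {F : Finset (Sym2 (Literal n))} (hF : F ⊆ arcClauses X)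
    {i j : Fin k} :
    Implies F (e i) (e j) ↔ Reachable (digraphOfClauses e F) i j := by
  constructor
  · intro h
    have key : ∀ y, Implies F (e i) y → ∃ j, e j = y ∧ Reachable (digraphOfClauses e F) i j := by
      intro y hy
      induction hy with
      | refl => exact ⟨i, rfl, Relation.ReflTransGen.refl⟩
      | @tail b c _ hbc ih =>
        obtain ⟨j, rfl, hj⟩ := ih
        obtain ⟨l, rfl⟩ := (heX c).mp
          (succClosed_of_subset_arcClauses hX hF _ _ hbc ((heX _).mpr ⟨j, rfl⟩))
        exact ⟨l, rfl, hj.tail hbc⟩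
    obtain ⟨j', hj', h'⟩ := key _ h
    rwa [← he hj']
  · intro h
    induction h with
    | refl => exact Implies.refl _ _
    | tail _ hbc ih => exact ih.trans (Implies.of_mem hbc)

/-- Each arc inside `X` is one clause, which also gives the mirrored arc among the negations.
Clauses of the pair therefore correspond to arcs of a single digraph on `X`. -/
theorem sum_ordinarySets (hX : Consistent X) (hne : X.Nonempty) (hk : X.card = k) :
    ∑ F ∈ ordinarySets X, (Polynomial.X : ℚ[X]) ^ F.card = sccSeq k := by
  classical
  let e : Fin k → Literal n := fun i => (X.equivFinOfCardEq hk).symm i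
  have he : Function.Injective e := fun i j h =>
    (X.equivFinOfCardEq hk).symm.injective (Subtype.ext h)
  have heX : ∀ x, x ∈ X ↔ ∃ i, e i = x := by
    intro x
    constructor
    · exact fun hx => ⟨X.equivFinOfCardEq hk ⟨x, hx⟩, by simp [e]⟩
    · rintro ⟨i, rfl⟩
      exact ((X.equivFinOfCardEq hk).symm i).2
  have heX' : ∀ i, e i ∈ X := fun i => (heX _).mpr ⟨i, rfl⟩
  have hsc : ∀ F ⊆ arcClauses X, ((∀ u ∈ X, ∀ v ∈ X, Implies F u v) ↔
      IsStronglyConnected (digraphOfClauses e F)) := by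
    intro F hF
    constructor
    · intro h
      obtain ⟨x, hx⟩ := hne
      obtain ⟨i, -⟩ := (heX x).mp hx
      exact ⟨⟨i⟩, fun i j => (implies_iff_reachable hX he heX hF).mp (h _ (heX' i) _ (heX' j))⟩
    · rintro h u hu v hv
      obtain ⟨i, rfl⟩ := (heX u).mp hu
      obtain ⟨j, rfl⟩ := (heX v).mp hv
      exact (implies_iff_reachable hX he heX hF).mpr (h.2 i j)
  have hleft : ∀ D : Digraph (Fin k), digraphOfClauses e (clausesOfDigraph e D) = D := by
    intro D
    ext i j
    exact mk_mem_clausesOfDigraph hX he heX'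
  have hsub : ∀ D : Digraph (Fin k), (∀ v, ¬ D.Adj v v) →
      clausesOfDigraph e D ⊆ arcClauses X := by
    intro D hD c hc
    obtain ⟨⟨i, j⟩, hij, rfl⟩ := Finset.mem_image.mp hc
    rw [mem_arcFinset] at hij
    refine mk_neg_mem_arcClauses.mpr ⟨fun h => hD i ?_, Or.inl ⟨heX' i, heX' j⟩⟩
    rwa [← he h] at hij
  symm
  refine Finset.sum_nbij' (clausesOfDigraph e) (digraphOfClauses e) ?_ ?_ ?_ ?_ ?_
  · intro D hD
    obtain ⟨-, h1, h2⟩ := Finset.mem_filter.mp hD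
    refine Finset.mem_filter.mpr ⟨Finset.mem_powerset.mpr (hsub D h1),
      (hsc _ (hsub D h1)).mpr ?_⟩
    rwa [hleft]
  · intro F hF
    obtain ⟨h1, h2⟩ := Finset.mem_filter.mp hF
    have h1 := Finset.mem_powerset.mp h1
    exact Finset.mem_filter.mpr ⟨Finset.mem_univ _,
      fun v hv => (mk_neg_mem_arcClauses.mp (h1 hv)).1 rfl, (hsc F h1).mp h2⟩
  · intro D _
    exact hleft D
  · intro F hF
    have h1 := Finset.mem_powerset.mp (Finset.mem_filter.mp hF).1
    ext c
    constructor
    · intro hc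
      obtain ⟨⟨i, j⟩, hij, rfl⟩ := Finset.mem_image.mp hc
      exact mem_arcFinset.mp hij
    · intro hc
      obtain ⟨⟨x, y⟩, hxy, rfl⟩ := Finset.mem_image.mp (h1 hc)
      obtain ⟨hx, hy, -⟩ := Finset.mem_offDiag.mp hxy
      obtain ⟨i, rfl⟩ := (heX x).mp hx
      obtain ⟨j, rfl⟩ := (heX y).mp hy
      exact Finset.mem_image.mpr ⟨(i, j), mem_arcFinset.mpr hc, rfl⟩
  · intro D _
    rw [clausesOfDigraph, Finset.card_image_of_injective _ (mk_neg_injective hX he heX'),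
      card_arcFinset]

theorem isTwoCNF_iff {F : Finset (Sym2 (Literal k))} :
    IsTwoCNF F ↔ F ⊆ clauses Finset.univ := by
  constructor
  · intro h c hc
    induction c with
    | _ x y => exact mk_mem_clauses.mpr ⟨h x y hc, Finset.mem_univ _, Finset.mem_univ _⟩
  · exact fun h x y hxy => (mk_mem_clauses.mp (h hxy)).1

/-- Over an empty set of variables the right side holds vacuously and the left side fails, hence the
restriction on `k`. -/
theorem isContradictorySCC_univ_iff [NeZero k] {F : Finset (Sym2 (Literal k))} :
    IsContradictorySCC F Set.univ ↔ ∀ u v, Implies F u v := by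
  constructor
  · intro h u v
    exact h.1.2.prop u (Set.mem_univ _) v (Set.mem_univ _)
  · intro h
    exact ⟨⟨⟨(0, true), Set.mem_univ _⟩, fun u _ v _ => h u v, fun S _ _ => Set.subset_univ S⟩,
      (0, true), Set.mem_univ _, h _ _, h _ _⟩

/-- The embedding of literals induced by an embedding of variables. -/
def literalEmbedding (e : Fin k ↪ Fin n) : Literal k ↪ Literal n :=
  e.prodMap (Function.Embedding.refl Bool)

theorem mk_mem_map (g : Literal k ↪ Literal n) {F : Finset (Sym2 (Literal k))}
    {x y : Literal k} : s(g x, g y) ∈ F.map g.sym2Map ↔ s(x, y) ∈ F := by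
  rw [← Finset.mem_map' g.sym2Map]
  rfl

theorem implies_map_iff (e : Fin k ↪ Fin n) {F : Finset (Sym2 (Literal k))} {u v : Literal k} :
    Implies (F.map (literalEmbedding e).sym2Map) (literalEmbedding e u) (literalEmbedding e v) ↔
      Implies F u v := by
  constructor
  · intro h
    have key : ∀ y, Implies (F.map (literalEmbedding e).sym2Map) (literalEmbedding e u) y →
        ∃ v, literalEmbedding e v = y ∧ Implies F u v := by
      intro y hy
      induction hy with
      | refl => exact ⟨u, rfl, Implies.refl _ _⟩
      | @tail b c _ hbc ih =>
        obtain ⟨v, rfl, hv⟩ := ih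
        obtain ⟨d, hd, hdc⟩ := Finset.mem_map.mp hbc
        obtain ⟨w, rfl⟩ : ∃ w, literalEmbedding e w = c := by
          have hmem : c ∈ (literalEmbedding e).sym2Map d := by
            rw [hdc]
            exact Sym2.mem_mk_right _ _
          obtain ⟨w, -, hw⟩ := Sym2.mem_map.mp hmem
          exact ⟨w, hw⟩
        refine ⟨w, rfl, hv.trans (Implies.of_mem ?_)⟩
        exact (mk_mem_map (literalEmbedding e)).mp hbc
    obtain ⟨v', hv', h'⟩ := key _ h
    rwa [← (literalEmbedding e).injective hv']
  · intro h
    induction h with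
    | refl => exact Implies.refl _ _
    | tail _ hbc ih =>
      exact ih.trans (Implies.of_mem ((mk_mem_map (literalEmbedding e)).mpr hbc))

theorem sum_contradictorySets {B : Finset (Fin n)} (hne : B.Nonempty) (hk : B.card = k) :
    ∑ F ∈ contradictorySets B, (Polynomial.X : ℚ[X]) ^ F.card = csccSeq k := by
  classical
  have : NeZero k := ⟨by rw [← hk]; exact hne.card_ne_zero⟩
  let e : Fin k ↪ Fin n := (B.equivFinOfCardEq hk).symm.toEmbedding.trans (.subtype _)
  have heB : ∀ i, i ∈ B ↔ ∃ j, e j = i := by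
    intro i
    constructor
    · exact fun hi => ⟨B.equivFinOfCardEq hk ⟨i, hi⟩, by simp [e]⟩
    · rintro ⟨j, rfl⟩
      exact ((B.equivFinOfCardEq hk).symm j).2
  let g := literalEmbedding e
  have hg1 : ∀ x : Literal k, (g x).1 = e x.1 := fun _ => rfl
  have hgB : ∀ x : Literal n, x.1 ∈ B ↔ ∃ y, g y = x := by
    intro x
    rw [heB]
    constructor
    · rintro ⟨j, hj⟩
      exact ⟨(j, x.2), Prod.ext hj rfl⟩
    · rintro ⟨y, rfl⟩
      exact ⟨y.1, rfl⟩
  have hcl : (clauses Finset.univ).map g.sym2Map = clauses B := by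
    ext c
    induction c with
    | _ x y =>
      constructor
      · intro h
        obtain ⟨d, hd, hdc⟩ := Finset.mem_map.mp h
        rw [← hdc]
        induction d with
        | _ u v =>
          have h1 := (mk_mem_clauses.mp hd).1
          exact mk_mem_clauses.mpr ⟨fun h => h1 (e.injective h), (hgB _).mpr ⟨u, rfl⟩,
            (hgB _).mpr ⟨v, rfl⟩⟩
      · intro h
        obtain ⟨h1, h2, h3⟩ := mk_mem_clauses.mp h
        obtain ⟨u, rfl⟩ := (hgB x).mp h2
        obtain ⟨v, rfl⟩ := (hgB y).mp h3
        exact (mk_mem_map g).mpr (mk_mem_clauses.mpr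
          ⟨fun h => h1 (congrArg e h), Finset.mem_univ _, Finset.mem_univ _⟩)
  have hiff : ∀ F : Finset (Sym2 (Literal k)),
      (∀ u v : Literal n, u.1 ∈ B → v.1 ∈ B → Implies (F.map g.sym2Map) u v) ↔
        ∀ u v, Implies F u v := by
    intro F
    constructor
    · exact fun h u v => (implies_map_iff e).mp
        (h (g u) (g v) ((hgB _).mpr ⟨u, rfl⟩) ((hgB _).mpr ⟨v, rfl⟩))
    · intro h u v hu hv
      obtain ⟨u, rfl⟩ := (hgB u).mp hu
      obtain ⟨v, rfl⟩ := (hgB v).mp hv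
      exact (implies_map_iff e).mpr (h u v)
  symm
  refine Finset.sum_bij (fun F _ => F.map g.sym2Map) ?_ ?_ ?_ ?_
  · intro F hF
    obtain ⟨-, h1, h2⟩ := Finset.mem_filter.mp hF
    refine Finset.mem_filter.mpr ⟨Finset.mem_powerset.mpr ?_, ?_⟩
    · rw [← hcl]
      exact Finset.map_subset_map.mpr (isTwoCNF_iff.mp h1)
    · exact (hiff F).mpr (isContradictorySCC_univ_iff.mp h2)
  · intro F _ F' _ h
    exact Finset.map_injective _ h
  · intro F hF
    obtain ⟨h1, h2⟩ := Finset.mem_filter.mp hF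
    rw [Finset.mem_powerset, ← hcl, Finset.subset_map_iff] at h1
    obtain ⟨F', hF', rfl⟩ := h1
    exact ⟨F', Finset.mem_filter.mpr ⟨Finset.mem_univ _, isTwoCNF_iff.mpr hF',
      isContradictorySCC_univ_iff.mpr ((hiff F').mp h2)⟩, rfl⟩
  · intro F _
    rw [Finset.card_map]

end Transfer

/-! ### The recursions -/

theorem sum_powerset_card_eq_sum_antidiagonal {α : Type*} (A : Finset α) (f : ℕ → ℕ → ℚ[X]) :
    ∑ B ∈ A.powerset, f B.card (A.card - B.card) =
      ∑ ij ∈ Finset.HasAntidiagonal.antidiagonal A.card,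
        (A.card.choose ij.1 : ℚ) • f ij.1 ij.2 := by
  rw [Finset.sum_powerset_apply_card (fun m => f m (A.card - m)),
    Finset.Nat.sum_antidiagonal_eq_sum_range_succ (fun i j => (A.card.choose i : ℚ) • f i j)]
  exact Finset.sum_congr rfl fun m _ => (Nat.cast_smul_eq_nsmul ℚ _ _).symm

/-- The numerators of the coefficients of `CSCC(z, w) - SCC(2z, w) / 2`. -/
def componentSeq (k : ℕ) : ℚ[X] :=
  csccSeq k - (1 / 2 : ℚ) • (2 ^ k * sccSeq k)

/-- Negating every literal exchanges the assignments with `a` true and those with `a` false. -/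
theorem two_mul_card_assignments_filter {a : Fin n} {B : Finset (Fin n)} (ha : a ∈ B) :
    2 * ((assignments B).filter ((a, true) ∈ ·)).card = 2 ^ B.card := by
  classical
  rw [← card_assignments, ← Finset.card_filter_add_card_filter_not (s := assignments B)
    ((a, true) ∈ ·), two_mul]
  congr 1
  have hneg : ∀ X ∈ assignments B, negSet X ∈ assignments B := fun X hX => by
    obtain ⟨h1, h2⟩ := mem_assignments.mp hX
    exact mem_assignments.mpr ⟨h1.negSet, by rw [vars_negSet, h2]⟩
  have hinv : ∀ X : Finset (Literal n), negSet (negSet X) = X := fun X => by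
    ext x
    rw [mem_negSet, mem_negSet, Literal.neg_neg]
  have hmem : ∀ X ∈ assignments B, ((a, true) ∈ negSet X ↔ ¬ (a, true) ∈ X) := fun X hX => by
    obtain ⟨h1, h2⟩ := mem_assignments.mp hX
    rw [← h2] at ha
    have h3 := (fst_mem_vars (x := (a, true))).mp ha
    have h4 := h1 (a, true)
    rw [mem_negSet]
    tauto
  refine Finset.card_nbij' negSet negSet ?_ ?_ (fun X _ => hinv X) fun X _ => hinv X
  · intro X hX
    obtain ⟨h1, h2⟩ := Finset.mem_filter.mp hX
    exact Finset.mem_filter.mpr ⟨hneg X h1, fun h => (hmem X h1).mp h h2⟩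
  · intro X hX
    obtain ⟨h1, h2⟩ := Finset.mem_filter.mp hX
    exact Finset.mem_filter.mpr ⟨hneg X h1, (hmem X h1).mpr h2⟩

theorem componentSum_eq_componentSeq {a : Fin n} {B : Finset (Fin n)} (ha : a ∈ B) :
    componentSum a B = componentSeq B.card := by
  have hord : ∀ X ∈ (assignments B).filter ((a, true) ∈ ·),
      ∑ F ∈ ordinarySets X, (Polynomial.X : ℚ[X]) ^ F.card = sccSeq B.card := by
    intro X hX
    obtain ⟨h1, h2⟩ := Finset.mem_filter.mp hX
    obtain ⟨hc, hv⟩ := mem_assignments.mp h1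
    exact sum_ordinarySets hc ⟨_, h2⟩ (by rw [← hc.card_vars, hv])
  rw [componentSum_eq ha, sum_contradictorySets ⟨a, ha⟩ rfl, Finset.sum_congr rfl hord,
    Finset.sum_const, componentSeq]
  congr 1
  have h := congrArg (Nat.cast : ℕ → ℚ[X]) (two_mul_card_assignments_filter ha)
  push_cast at h
  rw [← h, nsmul_eq_mul, mul_assoc, show (2 : ℚ[X]) = algebraMap ℚ ℚ[X] 2 from (map_ofNat _ 2).symm,
    ← Algebra.smul_def, smul_smul]
  norm_num

/-- The class of a marked `a` has `ij.1` further variables among the other `m`. The sequence `e` is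
left free so that the recursion can first prove that `signedSum` depends on the cardinality alone.
-/
theorem signedSum_succ {m : ℕ} {A : Finset (Fin n)} (hA : A.card = m + 1) (e : ℕ → ℚ[X])
    (he : ∀ B : Finset (Fin n), B.card ≤ m → signedSum B = e B.card) :
    signedSum A = ∑ ij ∈ Finset.HasAntidiagonal.antidiagonal m,
      (m.choose ij.1 : ℚ) • (componentSeq (ij.1 + 1) * e ij.2) := by
  classical
  obtain ⟨a, ha⟩ : A.Nonempty := Finset.card_pos.mp (by omega)
  have hA' : (A.erase a).card = m := by rw [Finset.card_erase_of_mem ha, hA]; rfl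
  have hsum := sum_powerset_card_eq_sum_antidiagonal (A.erase a)
    fun i j => componentSeq (i + 1) * e j
  rw [hA'] at hsum
  rw [signedSum_eq_sum_componentSum ha, ← hsum]
  refine Finset.sum_nbij' (fun B => B.erase a) (fun B => insert a B) ?_ ?_ ?_ ?_ ?_
  · intro B hB
    obtain ⟨h1, -⟩ := Finset.mem_filter.mp hB
    exact Finset.mem_powerset.mpr (Finset.erase_subset_erase a (Finset.mem_powerset.mp h1))
  · intro B hB
    have h1 := Finset.mem_powerset.mp hB
    exact Finset.mem_filter.mpr ⟨Finset.mem_powerset.mpr (Finset.insert_subset ha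
      (h1.trans (Finset.erase_subset a A))), Finset.mem_insert_self a B⟩
  · intro B hB
    exact Finset.insert_erase (Finset.mem_filter.mp hB).2
  · intro B hB
    exact Finset.erase_insert fun h => Finset.notMem_erase a A (Finset.mem_powerset.mp hB h)
  · intro B hB
    obtain ⟨h1, h2⟩ := Finset.mem_filter.mp hB
    have h1 := Finset.mem_powerset.mp h1
    have hpos : 0 < B.card := Finset.card_pos.mpr ⟨a, h2⟩
    have h3 : (A \ B).card = m - (B.card - 1) := by
      rw [Finset.card_sdiff_of_subset h1]
      omega
    rw [componentSum_eq_componentSeq h2, he _ (by omega), h3, Finset.card_erase_of_mem h2,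
      Nat.sub_add_cancel hpos]

/-- The signed count of the sets of clauses with `n` variables. -/
def signedSeq (n : ℕ) : ℚ[X] :=
  signedSum (Finset.univ : Finset (Fin n))

theorem signedSum_empty : signedSum (∅ : Finset (Fin n)) = 1 := by
  rw [signedSum, clauses_empty, Finset.powerset_empty, Finset.sum_singleton,
    signedWeight_of_contradictory (Finset.empty_subset _) (by simp)]
  simp

theorem signedSum_eq_signedSeq (A : Finset (Fin n)) : signedSum A = signedSeq A.card := by
  have key : ∀ m n (A : Finset (Fin n)), A.card = m → signedSum A = signedSeq m := by
    intro m
    induction m using Nat.strong_induction_on with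
    | _ m ih =>
      intro n A hA
      cases m with
      | zero =>
        rw [Finset.card_eq_zero.mp hA, signedSum_empty, signedSeq, Finset.univ_eq_empty,
          signedSum_empty]
      | succ m =>
        rw [signedSeq, signedSum_succ hA signedSeq fun B hB => ih _ (by omega) _ B rfl,
          signedSum_succ (Finset.card_fin (m + 1)) signedSeq
            fun B hB => ih _ (by omega) _ B rfl]
  exact key _ _ A rfl

theorem signedSeq_zero : signedSeq 0 = 1 := by
  rw [signedSeq, Finset.univ_eq_empty, signedSum_empty]

theorem signedSeq_succ (m : ℕ) :
    signedSeq (m + 1) = ∑ ij ∈ Finset.HasAntidiagonal.antidiagonal m,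
      (m.choose ij.1 : ℚ) • (componentSeq (ij.1 + 1) * signedSeq ij.2) :=
  signedSum_succ (Finset.card_fin (m + 1)) signedSeq fun B _ => signedSum_eq_signedSeq B

theorem satisfied_exponent (i j : ℕ) :
    j * (2 * (i + j) - j - 1) = 2 * i * j + j * (j - 1) := by
  cases j with
  | zero => simp
  | succ j =>
    rw [show 2 * (i + (j + 1)) - (j + 1) - 1 = 2 * i + j by omega, Nat.add_sub_cancel]
    ring

theorem one_add_X_pow_eq_sum_signedSeq (n : ℕ) :
    (1 + Polynomial.X : ℚ[X]) ^ (2 * (n * (n - 1))) =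
      ∑ ij ∈ Finset.HasAntidiagonal.antidiagonal n, (n.choose ij.1 : ℚ) • (signedSeq ij.1 *
        ((1 + Polynomial.X) ^ (2 * ij.1 * ij.2 + ij.2 * (ij.2 - 1)) *
          (2 ^ ij.2 * (1 + Polynomial.X) ^ ij.2.choose 2))) := by
  classical
  have h1 := one_add_X_pow_card_clauses (Finset.univ : Finset (Fin n))
  have h2 : ∀ T ∈ partials (Finset.univ : Finset (Fin n)),
      signedSum (Finset.univ \ vars T) *
        (1 + Polynomial.X) ^ (satisfied Finset.univ T).card =
      signedSeq (n - (vars T).card) * (1 + Polynomial.X) ^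
        ((vars T).card.choose 2 + (vars T).card * (2 * n - (vars T).card - 1)) := by
    intro T hT
    rw [card_satisfied hT, signedSum_eq_signedSeq,
      Finset.card_sdiff_of_subset (Finset.subset_univ _), Finset.card_fin,
      (mem_partials.mp hT).1.card_vars]
  rw [card_clauses, Finset.card_fin, Finset.sum_congr rfl h2,
    sum_partials_eq_sum_powerset _ fun B => signedSeq (n - B.card) *
      (1 + Polynomial.X) ^ (B.card.choose 2 + B.card * (2 * n - B.card - 1))] at h1
  have h3 := sum_powerset_card_eq_sum_antidiagonal (Finset.univ : Finset (Fin n))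
    fun j i => 2 ^ j • (signedSeq i *
      (1 + Polynomial.X) ^ (j.choose 2 + j * (2 * n - j - 1)))
  rw [Finset.card_fin] at h3
  -- The count over assigned sets lists the assigned size `j` first; the target lists the unassigned
  -- size `i` first.
  rw [h1, h3, ← Finset.Nat.sum_antidiagonal_swap]
  refine Finset.sum_congr rfl fun ij hij => ?_
  obtain ⟨i, j⟩ := ij
  have hn : i + j = n := Finset.HasAntidiagonal.mem_antidiagonal.mp hij
  have hch : n.choose j = n.choose i := by rw [← hn, Nat.choose_symm_add]
  have hex : j * (2 * n - j - 1) = 2 * i * j + j * (j - 1) := by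
    rw [← hn, satisfied_exponent]
  change (n.choose j : ℚ) • 2 ^ j • (signedSeq i * (1 + Polynomial.X) ^
      (j.choose 2 + j * (2 * n - j - 1))) = (n.choose i : ℚ) • (signedSeq i *
    ((1 + Polynomial.X) ^ (2 * i * j + j * (j - 1)) *
      (2 ^ j * (1 + Polynomial.X) ^ j.choose 2)))
  rw [hex, hch, nsmul_eq_mul, pow_add _ (j.choose 2), Nat.cast_pow, Nat.cast_ofNat]
  refine congrArg _ ?_
  ring

theorem componentSeq_zero : componentSeq 0 = 0 := by
  classical
  have h1 : csccSeq 0 = 0 := by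
    refine Finset.sum_eq_zero fun F hF => ?_
    obtain ⟨-, -, -, x, -⟩ := Finset.mem_filter.mp hF
    exact x.1.elim0
  have h2 : sccSeq 0 = 0 := by
    refine Finset.sum_eq_zero fun D hD => ?_
    obtain ⟨-, -, ⟨v⟩, -⟩ := Finset.mem_filter.mp hD
    exact v.elim0
  simp [componentSeq, h1, h2]

theorem csccGF_eq_add : csccGF =
    (1 / 2 : ℚ) • PowerSeries.rescale (2 : ℚ[X]) sccGF + egf componentSeq := by
  rw [csccGF_eq, sccGF_eq, rescale_egf]
  ext1 n
  rw [map_add, PowerSeries.coeff_smul, coeff_egf, coeff_egf, coeff_egf, componentSeq, smul_sub,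
    smul_comm (1 / 2 : ℚ) ((n.factorial : ℚ)⁻¹)]
  abel

theorem logOf_quotient_eq : PowerSeries.logOf (hadamard digraphGF
    (digraphGF * Ring.inverse (PowerSeries.rescale (2 : ℚ[X]) graphGF))) = egf componentSeq := by
  have hunit := isUnit_rescale_graphGF
  rw [graphGF_eq, rescale_egf] at hunit
  rw [graphGF_eq, rescale_egf, digraphGF_eq]
  refine logOf_hadamard_quotient hunit (by simp) componentSeq_zero signedSeq_zero signedSeq_succ
    -- The exponent is `(i + j)(i + j - 1) - i(i - 1)`, making this the quotient of the coefficients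
    -- of `D` at `i + j` and `i`.
    (fun i j => (1 + Polynomial.X) ^ (2 * i * j + j * (j - 1))) ?_ ?_ (by simp)
  · intro i j
    rw [← pow_add]
    congr 1
    cases i with
    | zero => simp
    | succ i =>
      cases j with
      | zero => simp
      | succ j =>
        rw [Nat.add_sub_cancel, Nat.add_sub_cancel,
          show i + 1 + (j + 1) - 1 = i + j + 1 by omega]
        ring
  · intro n
    rw [← pow_add, ← two_mul]
    exact one_add_X_pow_eq_sum_signedSeq n

end TwoSat

end
/-- `CSCC(z, w) = SCC(2z, w) / 2 + log (D(z, w) ⊙ (D(z, w) / G(2z, w)))`. -/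
theorem mainTheorem4 :
    TwoSat.csccGF =
      (1 / 2 : ℚ) • PowerSeries.rescale (2 : ℚ[X]) TwoSat.sccGF +
        PowerSeries.logOf
          (TwoSat.hadamard TwoSat.digraphGF
            (TwoSat.digraphGF *
              Ring.inverse (PowerSeries.rescale (2 : ℚ[X]) TwoSat.graphGF))) := by
  rw [TwoSat.logOf_quotient_eq]
  exact TwoSat.csccGF_eq_add
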